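/- Let $\ell$ be a prime, $E/\mathbb{Q}_\ell$ a finite extension, $\mathcal{O}$ its ring of integers and $\mathbb{F}$ the residue field of $\mathcal{O}$. Let $\underline n=(n_1,\dots,n_k)$, $k\ge 1$, be an ordered partition (a finite sequence of positive integers). For a ring $R$ let $\mathcal N^{\underline n}_R$ be the affine $R$-scheme whose points in an $R$-algebra $A$ are the tuples $(X_1,N_1,X_2,N_2,\dots,N_{k-1},X_k)$ of matrices $X_i\in M_{n_i\times n_i}(A)$, $N_i\in M_{n_i\times n_{i+1}}(A)$ with $X_iN_i=N_iX_{i+1}$ for $i=1,\dots,k-1$; write $\mathcal N^{\underline n}=\mathcal N^{\underline n}_{\mathcal O}$. Then $\mathcal N^{\underline n}$ is reduced, flat over $\mathcal O$ of relative dimension $\sum_{i=1}^k n_i^2$ (it is of finite type over $\mathcal{O}$ and every irreducible component of every fibre over $\operatorname{Spec}\mathcal O$ has dimension $\sum_{i=1}^k n_i^2$), and it is a complete intersection over $\mathcal O$. Moreover the special fibre $\mathcal N^{\underline n}_{\mathbb F}$ is reduced, is a complete intersection over $\mathbb F$, and has dimension $\sum_{i=1}^k n_i^2$. Here a scheme over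 a ring $R$ is called a complete intersection if it is isomorphic over $R$ to $\operatorname{Spec} R[x_1,\dots,x_d]/(g_1,\dots,g_c)$ for some $d$, $c$ and some regular sequence $g_1,\dots,g_c$ in $R[x_1,\dots,x_d]$. -/

import Mathlib

open CategoryTheory AlgebraicGeometry

universe u v

noncomputable section

namespace MatrixChain

/-- The tuples `(X_1, N_1, X_2, N_2, …, N_{k-1}, X_k)` over a ring `A`, for the sequence
`(n_1, …, n_k)` with `k = m + 1`: here `X_i` is an `n_i × n_i` matrix, `N_i` is an
`n_i × n_{i+1}` matrix, and `X_i N_i = N_i X_{i+1}` for `i = 1, …, k - 1`. -/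
structure Points {m : ℕ} (n : Fin (m + 1) → ℕ) (A : Type v) [CommRing A] where
  X : ∀ i : Fin (m + 1), Matrix (Fin (n i)) (Fin (n i)) A
  N : ∀ i : Fin m, Matrix (Fin (n i.castSucc)) (Fin (n i.succ)) A
  comm : ∀ i : Fin m, X i.castSucc * N i = N i * X i.succ

/-- The index set of the coordinates: the entries of all `X_i` and of all `N_i`. -/
abbrev Vars {m : ℕ} (n : Fin (m + 1) → ℕ) : Type :=
  (Σ i : Fin (m + 1), Fin (n i) × Fin (n i)) ⊕
    (Σ i : Fin m, Fin (n i.castSucc) × Fin (n i.succ))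

section

variable {m : ℕ} (n : Fin (m + 1) → ℕ) (R : Type u) [CommRing R]

/-- The generic matrix `X_i`. -/
def genX (i : Fin (m + 1)) : Matrix (Fin (n i)) (Fin (n i)) (MvPolynomial (Vars n) R) :=
  Matrix.of fun a b => MvPolynomial.X (Sum.inl ⟨i, (a, b)⟩)

/-- The generic matrix `N_i`. -/
def genN (i : Fin m) :
    Matrix (Fin (n i.castSucc)) (Fin (n i.succ)) (MvPolynomial (Vars n) R) :=
  Matrix.of fun a b => MvPolynomial.X (Sum.inr ⟨i, (a, b)⟩)

/-- The entries of the matrices `X_i N_i - N_i X_{i+1}`. -/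
def relation (s : Σ i : Fin m, Fin (n i.castSucc) × Fin (n i.succ)) :
    MvPolynomial (Vars n) R :=
  (genX n R s.1.castSucc * genN n R s.1 - genN n R s.1 * genX n R s.1.succ) s.2.1 s.2.2

/-- The coordinate ring of the scheme of tuples over `R`. -/
abbrev CoordRing : Type u :=
  MvPolynomial (Vars n) R ⧸ Ideal.span (Set.range (relation n R))

/-- The affine scheme over `R` of tuples `(X_1, N_1, …, N_{k-1}, X_k)` with
`X_i N_i = N_i X_{i+1}`. -/
def scheme : Scheme.{u} := Spec (CommRingCat.of (CoordRing n R))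

/-- The structure morphism of the scheme of tuples. -/
def toBase : scheme n R ⟶ Spec (CommRingCat.of R) :=
  Spec.map (CommRingCat.ofHom (algebraMap R (CoordRing n R)))

variable {n R} in
theorem map_relation {A : Type v} [CommRing A] [Algebra R A]
    (f : MvPolynomial (Vars n) R →ₐ[R] A)
    (s : Σ i : Fin m, Fin (n i.castSucc) × Fin (n i.succ)) :
    f (relation n R s) =
      ((genX n R s.1.castSucc).map f * (genN n R s.1).map f -
        (genN n R s.1).map f * (genX n R s.1.succ).map f) s.2.1 s.2.2 := by
  simp [relation, Matrix.mul_apply, map_sum]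

/-- The scheme of tuples represents the functor of tuples: for every `R`-algebra `A`, its
`A`-points over `R` are the tuples with entries in `A`. -/
def pointsEquiv (A : Type v) [CommRing A] [Algebra R A] :
    (CoordRing n R →ₐ[R] A) ≃ Points n A where
  toFun f :=
    { X := fun i => (genX n R i).map (f.comp (Ideal.Quotient.mkₐ R _))
      N := fun i => (genN n R i).map (f.comp (Ideal.Quotient.mkₐ R _))
      comm := by
        intro i
        ext a b
        have h := map_relation (f.comp (Ideal.Quotient.mkₐ R
          (Ideal.span (Set.range (relation n R))))) ⟨i, (a, b)⟩
        have h0 : Ideal.Quotient.mkₐ R (Ideal.span (Set.range (relation n R)))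
            (relation n R ⟨i, (a, b)⟩) = 0 :=
          Ideal.Quotient.eq_zero_iff_mem.2 (Ideal.subset_span ⟨_, rfl⟩)
        rw [AlgHom.comp_apply, h0, map_zero, Matrix.sub_apply] at h
        exact (sub_eq_zero.1 h.symm) }
  invFun P :=
    Ideal.Quotient.liftₐ _
      (MvPolynomial.aeval (Sum.elim (fun s => P.X s.1 s.2.1 s.2.2) (fun s => P.N s.1 s.2.1 s.2.2)))
      (by
        intro p hp
        rw [← RingHom.mem_ker]
        refine (Ideal.span_le.2 ?_) hp
        rintro _ ⟨s, rfl⟩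
        rw [SetLike.mem_coe, RingHom.mem_ker, map_relation]
        have hX : ∀ i, (genX n R i).map (MvPolynomial.aeval (R := R)
            (Sum.elim (fun s : Σ i : Fin (m + 1), Fin (n i) × Fin (n i) => P.X s.1 s.2.1 s.2.2)
              (fun s : Σ i : Fin m, Fin (n i.castSucc) × Fin (n i.succ) =>
                P.N s.1 s.2.1 s.2.2))) = P.X i := by
          intro i; ext a b; simp [genX]
        have hN : ∀ i, (genN n R i).map (MvPolynomial.aeval (R := R)
            (Sum.elim (fun s : Σ i : Fin (m + 1), Fin (n i) × Fin (n i) => P.X s.1 s.2.1 s.2.2)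
              (fun s : Σ i : Fin m, Fin (n i.castSucc) × Fin (n i.succ) =>
                P.N s.1 s.2.1 s.2.2))) = P.N i := by
          intro i; ext a b; simp [genN]
        rw [hX, hX, hN, P.comm, sub_self, Matrix.zero_apply])
  left_inv f := by
    refine Ideal.Quotient.algHom_ext _ (MvPolynomial.algHom_ext ?_)
    rintro (s | s) <;> exact (MvPolynomial.aeval_X _ _).trans rfl
  right_inv P := by
    cases P
    simp only [Points.mk.injEq]
    constructor
    · funext i; ext a b
      exact (MvPolynomial.aeval_X _ _).trans rfl
    · funext i; ext a b
      exact (MvPolynomial.aeval_X _ _).trans rfl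

end

/-- A scheme over `R` is a complete intersection if it is isomorphic over `R` to the closed
subscheme of an affine space over `R` cut out by a regular sequence. -/
def IsCompleteIntersection {R : Type u} [CommRing R] {X : Scheme.{u}}
    (f : X ⟶ Spec (CommRingCat.of R)) : Prop :=
  ∃ (d c : ℕ) (g : Fin c → MvPolynomial (Fin d) R),
    RingTheory.Sequence.IsRegular (MvPolynomial (Fin d) R) (List.ofFn g) ∧
    ∃ e : X ≅ Spec (CommRingCat.of (MvPolynomial (Fin d) R ⧸ Ideal.span (Set.range g))),
      e.hom ≫ Spec.map (CommRingCat.ofHom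
        (algebraMap R (MvPolynomial (Fin d) R ⧸ Ideal.span (Set.range g)))) = f

/-- A morphism has relative dimension `d` if it is locally of finite type and every irreducible
component of every fibre has dimension `d`. -/
def HasRelativeDimension {X Y : Scheme.{u}} (f : X ⟶ Y) (d : ℕ) : Prop :=
  LocallyOfFiniteType f ∧
    ∀ y : Y, ∀ Z ∈ irreducibleComponents (f.fiber y), topologicalKrullDim Z = d

end MatrixChain

end

/-! Over a field, stratify the tuples by the isomorphism type of the chain `N`, a representation of
a linearly oriented quiver of type A. Such a chain is a sum of intervals, hence is conjugate to a
0-1 chain determined by labels on basis vectors. If the commutant of that chain has dimension `e`,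
its stabilizer, being the unit group of the commutant, has dimension `e` too. The orbit then has
dimension `∑ n_i ^ 2 - e`, the `X` over each point form a linear space of dimension `e`, and every
stratum has dimension `∑ n_i ^ 2`. There are finitely many strata, but the count is made at one
field-valued point at a time, as a bound on transcendence degree (`exists_generating_conjugation`,
`trdeg_le_and_linearIndependent`).

When a point attains this bound, its `X` is generic in the commutant. The linearized relations are
then surjective, because they already are at diagonal matrices with one indeterminate per label. So
the coordinate ring is reduced at the generic points of maximal dimension.

There is one relation per entry of the `N_i`, so the number of relations equals the codimension.
They are homogeneous, so a depth argument at the origin shows that they form a regular sequence and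
that all associated primes are minimal of dimension `∑ n_i ^ 2`
(`MvPolynomial.isWeaklyRegular_and_associatedPrimes`). Together with generic reducedness this
settles every field.

Regularity modulo `ℓ` lifts to `ℤ_[ℓ]` and makes `ℓ` a non-zero-divisor on the quotient
(`MvPolynomial.isWeaklyRegular_of_map`). Flatness and regularity pass to the ring of integers by
flat base change. Reducedness is inherited from the generic fibre, and the relative dimension comes
from the field case applied to residue fields. -/

noncomputable section

/-! ### Depth and regular sequences over a Noetherian local ring -/

section Depth

set_option linter.unusedSectionVars false

open IsLocalRing RingTheory.Sequence Abelian Pointwise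

variable {R : Type u} [CommRing R] [IsLocalRing R] [IsNoetherianRing R]

/-- There is an `M`-regular sequence of length `n` in the maximal ideal. -/
def HasDepth (R : Type u) [CommRing R] [IsLocalRing R] (M : Type u) [AddCommGroup M] [Module R M]
    (n : ℕ) : Prop :=
  ∃ rs : List R, rs.length = n ∧ (∀ r ∈ rs, r ∈ maximalIdeal R) ∧ IsRegular M rs

variable {M : Type u} [AddCommGroup M] [Module R M]

theorem HasDepth.congr {M' : Type u} [AddCommGroup M'] [Module R M'] {n : ℕ}
    (h : HasDepth R M n) (e : M ≃ₗ[R] M') : HasDepth R M' n := by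
  obtain ⟨rs, h1, h2, h3⟩ := h
  exact ⟨rs, h1, h2, (e.isRegular_congr rs).1 h3⟩

theorem maximalIdeal_smul_top_lt [Module.Finite R M] [Nontrivial M] :
    maximalIdeal R • (⊤ : Submodule R M) < ⊤ :=
  lt_top_iff_ne_top.2 (Submodule.top_ne_ideal_smul_of_le_jacobson_annihilator
    (maximalIdeal_le_jacobson _)).symm

/-- The element `a` need not belong to the given sequence. Depth is therefore read off from the
vanishing of Ext groups into `M`, and the long exact sequence for multiplication by `a` costs one
degree. -/
theorem HasDepth.quotSMulTop [Module.Finite R M] [Nontrivial M] {n : ℕ} (h : HasDepth R M (n + 1))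
    {a : R} (ha : a ∈ maximalIdeal R) (hreg : IsSMulRegular M a) :
    HasDepth R (QuotSMulTop a M) n := by
  have h1 := ((ModuleCat.exists_isRegular_tfae (maximalIdeal R) (n + 1) (ModuleCat.of R M)
    maximalIdeal_smul_top_lt).out 3 1).1 h
  have : Nontrivial (QuotSMulTop a M) := nontrivial_quotSMulTop_of_mem_maximalIdeal M ha
  refine ((ModuleCat.exists_isRegular_tfae (maximalIdeal R) n
    (ModuleCat.of R (QuotSMulTop a M)) maximalIdeal_smul_top_lt).out 1 3).1 fun i hi => ?_
  have zero1 := AddCommGrpCat.isZero_of_iff_subsingleton.mpr (h1 i (by omega))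
  have zero2 := AddCommGrpCat.isZero_of_iff_subsingleton.mpr (h1 (i + 1) (by omega))
  exact AddCommGrpCat.subsingleton_of_isZero <| ShortComplex.Exact.isZero_of_both_zeros
    ((Ext.covariant_sequence_exact₃' _
      (IsSMulRegular.smulShortComplex_shortExact (M := ModuleCat.of R M) hreg)) i (i + 1) rfl)
    (zero1.eq_zero_of_src _) (zero2.eq_zero_of_tgt _)

/-- An associated prime of `M` and an `M`-regular element of the maximal ideal lie in a common
associated prime of the quotient. -/
theorem exists_associatedPrime_quotSMulTop [Module.Finite R M] {a : R} (ha : a ∈ maximalIdeal R)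
    (hreg : IsSMulRegular M a) {P : Ideal R} (hP : P ∈ associatedPrimes R M) :
    ∃ Q ∈ associatedPrimes R (QuotSMulTop a M), P ≤ Q ∧ a ∈ Q := by
  obtain ⟨hPp, x, hx⟩ := isAssociatedPrime_iff.1 hP
  have hxP : ∀ p, p ∈ P ↔ p • x = 0 := fun p => by rw [hx, Submodule.mem_colon_singleton]; rfl
  set T : Submodule R M := Submodule.torsionBySet R M P with hT
  have hxT : x ∈ T := (Submodule.mem_torsionBySet_iff _ _).2 fun p => (hxP p).1 p.2
  -- If all `P`-torsion lay in `aM`, regularity of `a` would give `T = aT`, and Nakayama would give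
  -- `T = 0`, although `x` is a nonzero element of `T`.
  obtain ⟨y, hyT, hy⟩ : ∃ y ∈ T, y ∉ a • (⊤ : Submodule R M) := by
    by_contra! hcon
    have hle : T ≤ Ideal.span {a} • T := by
      intro y hy
      obtain ⟨z, -, rfl⟩ := (Submodule.mem_smul_pointwise_iff_exists _ _ _).1 (hcon y hy)
      rw [Submodule.ideal_span_singleton_smul]
      refine Submodule.smul_mem_pointwise_smul _ _ _ ?_
      refine (Submodule.mem_torsionBySet_iff _ _).2 fun p => hreg ?_
      have := (Submodule.mem_torsionBySet_iff _ _).1 hy p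
      change a • ((p : R) • z) = a • 0
      rw [smul_comm, smul_zero]
      exact this
    have hbot := Submodule.eq_bot_of_le_smul_of_le_jacobson_bot (Ideal.span {a}) T
      (IsNoetherian.noetherian T) hle (by
        rw [Ideal.span_singleton_le_iff_mem]; exact maximalIdeal_le_jacobson _ ha)
    rw [hbot, Submodule.mem_bot] at hxT
    exact hPp.ne_top ((Ideal.eq_top_iff_one _).2 ((hxP 1).2 (by simp [hxT])))
  obtain ⟨Q, hQ, hle⟩ := exists_le_isAssociatedPrime_of_isNoetherianRing R
    (Submodule.Quotient.mk y : QuotSMulTop a M) (by rwa [Ne, Submodule.Quotient.mk_eq_zero])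
  refine ⟨Q, hQ, fun p hp => hle ?_, hle ?_⟩
  · rw [Submodule.mem_colon_singleton, Submodule.mem_bot, ← Submodule.Quotient.mk_smul,
      (Submodule.mem_torsionBySet_iff _ _).1 hyT ⟨p, hp⟩, Submodule.Quotient.mk_zero]
  · rw [Submodule.mem_colon_singleton, Submodule.mem_bot, ← Submodule.Quotient.mk_smul,
      Submodule.Quotient.mk_eq_zero]
    exact Submodule.smul_mem_pointwise_smul _ _ _ trivial

theorem ringKrullDim_quotient_add_one_le_of_lt {A : Type*} [CommRing A] {P Q : Ideal A}
    [hP : P.IsPrime] (hPQ : P < Q) :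
    ringKrullDim (A ⧸ Q) + 1 ≤ ringKrullDim (A ⧸ P) := by
  obtain ⟨a, haQ, haP⟩ := SetLike.exists_of_lt hPQ
  refine ringKrullDim_succ_le_of_surjective (r := Ideal.Quotient.mk P a)
    (Ideal.Quotient.factor hPQ.le) (Ideal.Quotient.factor_surjective hPQ.le) ?_ ?_
  · exact mem_nonZeroDivisors_of_ne_zero (by rwa [Ne, Ideal.Quotient.eq_zero_iff_mem])
  · simpa [Ideal.Quotient.eq_zero_iff_mem] using haQ

/-- Dividing by a regular element `a` moves `P` into an associated prime `Q` of the quotient that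
contains `a`. The inclusion is strict since `a` is not in `P`, so each step costs at least one
dimension. -/
theorem HasDepth.le_ringKrullDim_quotient [Module.Finite R M] {n : ℕ} (h : HasDepth R M n)
    {P : Ideal R} (hP : P ∈ associatedPrimes R M) : (n : WithBot ℕ∞) ≤ ringKrullDim (R ⧸ P) := by
  induction n generalizing M P with
  | zero =>
    have := hP.isPrime
    simpa using ringKrullDim_nonneg_of_nontrivial (R := R ⧸ P)
  | succ n ih =>
    obtain ⟨rs, hl, hm, hr⟩ := h
    obtain ⟨a, rs, rfl⟩ := List.exists_cons_of_length_eq_add_one hl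
    rw [isRegular_cons_iff] at hr
    have ham : a ∈ maximalIdeal R := hm a (by simp)
    obtain ⟨Q, hQ, hPQ, haQ⟩ := exists_associatedPrime_quotSMulTop ham hr.1 hP
    have hlt : P < Q := by
      refine lt_of_le_of_ne hPQ ?_
      rintro rfl
      obtain ⟨hPp, x, hx⟩ := isAssociatedPrime_iff.1 hP
      have h0 : a • x = 0 := by
        have := haQ
        rw [hx, Submodule.mem_colon_singleton] at this
        exact this
      have hx0 : x = 0 := hr.1 (by simpa using h0)
      refine hPp.ne_top ((Ideal.eq_top_iff_one _).2 ?_)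
      rw [hx, Submodule.mem_colon_singleton]
      simp [hx0]
    have := hP.isPrime
    have h1 := ih (M := QuotSMulTop a M) ⟨rs, by simpa using hl,
      fun r hr => hm r (List.mem_cons_of_mem _ hr), hr.2⟩ hQ
    calc ((n + 1 : ℕ) : WithBot ℕ∞) = n + 1 := by push_cast; rfl
      _ ≤ ringKrullDim (R ⧸ Q) + 1 := by gcongr
      _ ≤ _ := ringKrullDim_quotient_add_one_le_of_lt hlt

theorem exists_associatedPrime_of_not_isSMulRegular {a : R} (h : ¬ IsSMulRegular M a) :
    ∃ P ∈ associatedPrimes R M, a ∈ P := by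
  have : a ∈ ⋃ p ∈ associatedPrimes R M, (p : Set R) := by
    rw [biUnion_associatedPrimes_eq_zero_divisors]
    by_contra hcon
    refine h ((isSMulRegular_iff_right_eq_zero_of_smul).2 fun x hx => ?_)
    by_contra h0
    exact hcon ⟨x, h0, hx⟩
  simpa using this

theorem supportDim_le_add_length [Module.Finite R M] (gs : List R)
    (hgs : ∀ g ∈ gs, g ∈ maximalIdeal R) :
    Module.supportDim R M ≤
      Module.supportDim R (M ⧸ (Ideal.ofList gs • ⊤ : Submodule R M)) + gs.length := by
  induction gs generalizing M with
  | nil =>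
    rw [Ideal.ofList_nil, Submodule.bot_smul]
    simpa using (Module.supportDim_eq_of_equiv (Submodule.quotEquivOfEqBot ⊥ rfl)).ge
  | cons g gs ih =>
    have h1 := Module.supportDim_le_supportDim_quotSMulTop_succ (M := M) (hgs g (by simp))
    have h2 := ih (M := QuotSMulTop g M) fun x hx => hgs x (List.mem_cons_of_mem _ hx)
    rw [Module.supportDim_eq_of_equiv
      (Submodule.quotOfListConsSMulTopEquivQuotSMulTopInner M g gs)]
    calc _ ≤ _ := h1
      _ ≤ _ := add_le_add_left h2 1
      _ = _ := by push_cast [List.length_cons]; rw [add_assoc]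

theorem IsAssociatedPrime.ringKrullDim_quotient_le_supportDim [Module.Finite R M] {P : Ideal R}
    (hP : P ∈ associatedPrimes R M) {a : R} (ha : a ∈ P) :
    ringKrullDim (R ⧸ P) ≤ Module.supportDim R (QuotSMulTop a M) := by
  have hPp := hP.isPrime
  have hmem : (⟨P, hPp⟩ : PrimeSpectrum R) ∈ Module.support R (QuotSMulTop a M) := by
    rw [Module.support_quotSMulTop]
    refine ⟨?_, by simpa using ha⟩
    rw [Module.support_eq_zeroLocus, PrimeSpectrum.mem_zeroLocus]
    exact Submodule.annihilator_top.symm.le.trans (IsAssociatedPrime.annihilator_le hP)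
  rw [Module.supportDim_eq_ringKrullDim_quotient_annihilator]
  have hle := Module.annihilator_le_of_mem_support hmem
  exact ringKrullDim_le_of_surjective (Ideal.Quotient.factor hle)
    (Ideal.Quotient.factor_surjective hle)

/-- If the first element `g` were a zero divisor, it would lie in an associated prime `P`. Depth
forces `R ⧸ P` to have dimension at least that depth. But `P` lies in the support of `M/gM`, whose
dimension is smaller, since the remaining elements can lower it only by their number. -/
theorem HasDepth.isWeaklyRegular_and_hasDepth [Module.Finite R M] [Nontrivial M] {n c : ℕ}
    (h : HasDepth R M (n + c))
    (gs : List R) (hlen : gs.length = c) (hgs : ∀ g ∈ gs, g ∈ maximalIdeal R)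
    (hdim : Module.supportDim R (M ⧸ (Ideal.ofList gs • ⊤ : Submodule R M)) ≤ n) :
    IsWeaklyRegular M gs ∧ HasDepth R (M ⧸ (Ideal.ofList gs • ⊤ : Submodule R M)) n := by
  induction c generalizing M gs with
  | zero =>
    obtain rfl := List.eq_nil_of_length_eq_zero hlen
    refine ⟨.nil _ _, h.congr (Submodule.quotEquivOfEqBot _ ?_).symm⟩
    rw [Ideal.ofList_nil, Submodule.bot_smul]
  | succ c ih =>
    obtain ⟨g, gs, rfl⟩ := List.exists_cons_of_length_eq_add_one hlen
    have hg : g ∈ maximalIdeal R := hgs g (by simp)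
    have hgs' : ∀ x ∈ gs, x ∈ maximalIdeal R := fun x hx => hgs x (List.mem_cons_of_mem _ hx)
    have : Nontrivial (QuotSMulTop g M) := nontrivial_quotSMulTop_of_mem_maximalIdeal M hg
    rw [Module.supportDim_eq_of_equiv
      (Submodule.quotOfListConsSMulTopEquivQuotSMulTopInner M g gs)] at hdim
    have hd1 : Module.supportDim R (QuotSMulTop g M) ≤ (n + c : ℕ) := by
      refine (supportDim_le_add_length gs hgs').trans ?_
      rw [show gs.length = c by simpa using hlen]
      push_cast
      gcongr
    have hreg : IsSMulRegular M g := by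
      by_contra hcon
      obtain ⟨P, hP, hgP⟩ := exists_associatedPrime_of_not_isSMulRegular hcon
      have h1 := h.le_ringKrullDim_quotient hP
      have h2 := (h1.trans (IsAssociatedPrime.ringKrullDim_quotient_le_supportDim hP hgP)).trans hd1
      have : n + (c + 1) ≤ n + c := by exact_mod_cast h2
      omega
    obtain ⟨h1, h2⟩ := ih (HasDepth.quotSMulTop (n := n + c) h hg hreg) gs (by simpa using hlen)
      hgs' hdim
    exact ⟨.cons hreg h1, h2.congr (Submodule.quotOfListConsSMulTopEquivQuotSMulTopInner M g gs).symm⟩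

end Depth

/-! ### Interval decomposition and normal form of chains of linear maps -/

namespace Chain

section

variable {L : Type u} [Field L] {m : ℕ} {E : Fin (m + 1) → Type v} [∀ t, AddCommGroup (E t)]
  [∀ t, Module L (E t)] (f : ∀ i : Fin m, E i.castSucc →ₗ[L] E i.succ)

/-- The endomorphism of the product of the spaces of a chain given by the maps of the chain. -/
def shift : (∀ t, E t) →ₗ[L] ∀ t, E t :=
  LinearMap.pi fun t => Fin.cases (motive := fun t => (∀ t, E t) →ₗ[L] E t) 0
    (fun i => f i ∘ₗ LinearMap.proj i.castSucc) t

@[simp] theorem shift_zero (x : ∀ t, E t) : shift f x 0 = 0 := rfl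

@[simp] theorem shift_succ (x : ∀ t, E t) (i : Fin m) :
    shift f x i.succ = f i (x i.castSucc) := rfl

theorem shift_single (i : Fin m) (w : E i.castSucc) :
    shift f (Pi.single i.castSucc w) = Pi.single i.succ (f i w) := by
  ext t
  refine Fin.cases ?_ (fun j => ?_) t
  · rw [shift_zero, Pi.single_eq_of_ne (Fin.succ_ne_zero i).symm]
  · rw [shift_succ]
    by_cases h : j = i
    · subst h; simp
    · rw [Pi.single_eq_of_ne (by simpa using h), Pi.single_eq_of_ne (by simpa using h), map_zero]

theorem shift_pow_single_apply (k : ℕ) (t s : Fin (m + 1)) (w : E t) (h : (s : ℕ) ≠ t + k) :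
    (shift f ^ k) (Pi.single t w) s = 0 := by
  induction k generalizing s with
  | zero => exact Pi.single_eq_of_ne (fun hs => h (by simp [hs])) w
  | succ k ih =>
    rw [pow_succ', Module.End.mul_apply]
    refine Fin.cases (fun _ => ?_) (fun j h => ?_) s h
    · rfl
    · rw [shift_succ, ih j.castSucc (by simp at h ⊢; omega), map_zero]

theorem shift_pow_mem {W : ∀ t, Submodule L (E t)}
    (hW : ∀ i, ∀ w : E i.castSucc, w ∈ W i.castSucc → f i w ∈ W i.succ) (k : ℕ) (x : ∀ t, E t) (hx : ∀ t, x t ∈ W t)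
    (t : Fin (m + 1)) : (shift f ^ k) x t ∈ W t := by
  induction k generalizing t with
  | zero => exact hx t
  | succ k ih =>
    rw [pow_succ', Module.End.mul_apply]
    refine Fin.cases ?_ (fun j => ?_) t
    · exact zero_mem _
    · exact hW j _ (ih _)

/-- A nonzero chain of subspaces splits off a one-dimensional interval. -/
theorem exists_split (W : ∀ t, Submodule L (E t))
    (hW : ∀ i, ∀ w : E i.castSucc, w ∈ W i.castSucc → f i w ∈ W i.succ) (hne : ∃ t, W t ≠ ⊥) :
    ∃ (e : ∀ t, E t) (W' : ∀ t, Submodule L (E t)), e ≠ 0 ∧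
      (∀ i, e i.castSucc ≠ 0 → f i (e i.castSucc) = e i.succ) ∧
      (∀ i, ∀ w : E i.castSucc, w ∈ W' i.castSucc → f i w ∈ W' i.succ) ∧
      (∀ t, e t ∈ W t ∧ W' t ≤ W t ∧ ∀ w ∈ W t, ∃ c : L, w - c • e t ∈ W' t) ∧
      (∀ t, ∀ c : L, c • e t ∈ W' t → e t ≠ 0 → c = 0) := by
  classical
  -- Choose a vector `v` of `W` that survives as many maps as possible. The interval it spans splits
  -- off, as the longest Jordan block of a nilpotent map does.
  obtain ⟨ℓ, ⟨a, v, hv, hv0⟩, hmax⟩ : ∃ ℓ, (∃ t, ∃ w ∈ W t, (shift f ^ ℓ) (Pi.single t w) ≠ 0) ∧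
      ∀ t, ∀ w ∈ W t, (shift f ^ (ℓ + 1)) (Pi.single t w) = 0 := by
    by_contra! hcon
    have hall : ∀ k, ∃ t, ∃ w ∈ W t, (shift f ^ k) (Pi.single t w) ≠ 0 := by
      intro k
      induction k with
      | zero =>
        obtain ⟨t, ht⟩ := hne
        obtain ⟨w, hw, hw0⟩ := (Submodule.ne_bot_iff _).1 ht
        exact ⟨t, w, hw, by simpa using hw0⟩
      | succ k ih =>
        obtain ⟨t, w, hw, hw0⟩ := ih
        exact hcon k ⟨t, w, hw, hw0⟩
    obtain ⟨t, w, -, hw0⟩ := hall (m + 1)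
    exact hw0 (funext fun s => shift_pow_single_apply f _ _ _ _ (by omega))
  obtain ⟨b, hb⟩ := Function.ne_iff.1 hv0
  have hab : (b : ℕ) = a + ℓ := by
    by_contra h
    exact hb (shift_pow_single_apply f _ _ _ _ h)
  obtain ⟨φ, hφ⟩ := Module.Projective.exists_dual_ne_zero L hb
  set x : ℕ → ∀ t, E t := fun k => (shift f ^ k) (Pi.single a v) with hx
  have hx0 : ∀ k (s : Fin (m + 1)), (s : ℕ) ≠ a + k → x k s = 0 := fun k s h =>
    shift_pow_single_apply f _ _ _ _ h
  have hxs : ∀ k, shift f (x k) = x (k + 1) := fun k => by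
    simp only [hx, pow_succ', Module.End.mul_apply]
  have hxl : x (ℓ + 1) = 0 := hmax a v hv
  have hxW : ∀ k t, x k t ∈ W t := fun k t => by
    refine shift_pow_mem f hW k _ (fun s => ?_) t
    by_cases h : s = a
    · subst h; simpa using hv
    · rw [Pi.single_eq_of_ne h]; exact zero_mem _
  set e : ∀ t, E t := ∑ k ∈ Finset.range (ℓ + 1), x k with he
  have het : ∀ t, e t = ∑ k ∈ Finset.range (ℓ + 1), x k t := fun t => by
    rw [he, Finset.sum_apply]
  have he1 : ∀ (t : Fin (m + 1)) (k : ℕ), (t : ℕ) = a + k → k ≤ ℓ → e t = x k t := by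
    intro t k htk hk
    rw [het, Finset.sum_eq_single k]
    · intro j _ hj; exact hx0 j t (by omega)
    · intro h; simp at h; omega
  have he2 : ∀ (t : Fin (m + 1)), ((t : ℕ) < a ∨ (b : ℕ) < t) → e t = 0 := by
    intro t ht
    rw [het]
    refine Finset.sum_eq_zero fun k hk => hx0 k t ?_
    simp at hk
    omega
  -- `ψ` pulls the functional `φ` at the end `b` of the interval back to all earlier vertices. It is
  -- nonzero on `e t` for `t` between `a` and `b`, so its kernel in `W t` is a complement to the
  -- line of `e t`.
  set ψ : (∀ t, E t) →ₗ[L] L :=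
    ∑ k ∈ Finset.range (ℓ + 1), (φ ∘ₗ LinearMap.proj b) ∘ₗ (shift f ^ k) with hψ
  have hψa : ∀ y, ψ y = ∑ k ∈ Finset.range (ℓ + 1), φ ((shift f ^ k) y b) := fun y => by
    simp [hψ]
  have hψs : ∀ (t : Fin (m + 1)) (k : ℕ) (w : E t), (b : ℕ) = t + k → k ≤ ℓ →
      ψ (Pi.single t w) = φ ((shift f ^ k) (Pi.single t w) b) := by
    intro t k w htk hk
    rw [hψa, Finset.sum_eq_single k]
    · intro j _ hj
      rw [shift_pow_single_apply f _ _ _ _ (by omega), map_zero]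
    · intro h; simp at h; omega
  have hψ0 : ∀ (t : Fin (m + 1)) (w : E t), ((t : ℕ) < a ∨ (b : ℕ) < t) →
      ψ (Pi.single t w) = 0 := by
    intro t w ht
    rw [hψa]
    refine Finset.sum_eq_zero fun k hk => ?_
    simp at hk
    rw [shift_pow_single_apply f _ _ _ _ (by omega), map_zero]
  have hψe : ∀ t : Fin (m + 1), (a : ℕ) ≤ t → (t : ℕ) ≤ b →
      ψ (Pi.single t (e t)) = φ (x ℓ b) := by
    intro t h1 h2
    have hs : Pi.single t (e t) = x (t - a) := by
      funext s
      by_cases h : s = t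
      · subst h
        rw [Pi.single_eq_same]
        exact he1 s _ (by omega) (by omega)
      · rw [Pi.single_eq_of_ne h, hx0]
        intro h'; exact h (Fin.ext (by omega))
    rw [hψs t (b - t) _ (by omega) (by omega), hs, hx]
    dsimp only
    rw [← Module.End.mul_apply, ← pow_add, show (b : ℕ) - t + (t - a) = ℓ by omega]
  have hcase : ∀ t : Fin (m + 1), ((a : ℕ) ≤ t ∧ (t : ℕ) ≤ b) ∨ ((t : ℕ) < a ∨ (b : ℕ) < t) :=
    fun t => by omega
  refine ⟨e, fun t => W t ⊓ LinearMap.ker (ψ ∘ₗ LinearMap.single L E t), ?_, ?_, ?_, ?_, ?_⟩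
  · intro h0
    have := hψe b (by omega) le_rfl
    rw [h0] at this
    simp at this
    exact hφ this.symm
  · intro i hi
    have h1 := hcase i.castSucc
    have h2 : shift f e i.succ = e i.succ := by
      have : shift f e = e - x 0 := by
        rw [he, map_sum, Finset.sum_congr rfl fun k _ => hxs k, Finset.sum_range_succ, hxl,
          Finset.sum_range_succ' x, add_zero, add_sub_cancel_right]
      rw [this, Pi.sub_apply, hx0 0, sub_zero]
      rcases h1 with h1 | h1
      · simp at h1 ⊢; omega
      · exact absurd (he2 _ h1) hi
    rw [← h2, shift_succ]
  -- The complement is stable. Before `b`, applying `f` only shifts the sum defining `ψ`, and the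
  -- new top term vanishes by maximality of `ℓ`. From `b` the image lands beyond `b`, where `ψ` is
  -- zero.
  · rintro i w ⟨hw, hwψ⟩
    refine ⟨hW i w hw, ?_⟩
    change ψ (Pi.single i.castSucc w) = 0 at hwψ
    change ψ (Pi.single i.succ (f i w)) = 0
    by_cases hib : (i.castSucc : ℕ) = b
    · exact hψ0 _ _ (Or.inr (by simp at hib ⊢; omega))
    · rw [← shift_single, hψa]
      rw [hψa, Finset.sum_range_succ', pow_zero, Module.End.one_apply,
        Pi.single_eq_of_ne (fun h => hib (by rw [h])), map_zero, add_zero] at hwψ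
      rw [Finset.sum_range_succ, ← Module.End.mul_apply (shift f ^ ℓ), ← pow_succ, hmax _ w hw,
        Pi.zero_apply, map_zero, add_zero, ← hwψ]
      refine Finset.sum_congr rfl fun k _ => ?_
      rw [← Module.End.mul_apply, ← pow_succ]
  · intro t
    have heW : e t ∈ W t := by
      rw [het]; exact Submodule.sum_mem _ fun k _ => hxW k t
    refine ⟨heW, inf_le_left, fun w hw => ?_⟩
    rcases hcase t with ht | ht
    · refine ⟨ψ (Pi.single t w) / φ (x ℓ b), Submodule.sub_mem _ hw (Submodule.smul_mem _ _ heW), ?_⟩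
      change ψ (Pi.single t (w - _ • e t)) = 0
      rw [Pi.single_sub, Pi.single_smul, map_sub, map_smul, hψe t ht.1 ht.2, smul_eq_mul,
        div_mul_cancel₀ _ hφ, sub_self]
    · refine ⟨0, ?_⟩
      rw [zero_smul, sub_zero]
      exact ⟨hw, hψ0 t w ht⟩
  · rintro t c ⟨-, hc⟩ het0
    change ψ (Pi.single t (c • e t)) = 0 at hc
    rcases hcase t with ht | ht
    · rw [Pi.single_smul, map_smul, hψe t ht.1 ht.2, smul_eq_mul] at hc
      exact (mul_eq_zero.1 hc).resolve_right hφ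
    · exact absurd (he2 t ht) het0

/-- A chain of finite-dimensional spaces has bases made of intervals. -/
theorem exists_interval_basis [∀ t, FiniteDimensional L (E t)] (W : ∀ t, Submodule L (E t))
    (hW : ∀ i, ∀ w : E i.castSucc, w ∈ W i.castSucc → f i w ∈ W i.succ) :
    ∃ (r : ℕ) (e : Fin r → ∀ t, E t),
      (∀ j i, e j i.castSucc ≠ 0 → f i (e j i.castSucc) = e j i.succ) ∧
      (∀ t, Submodule.span L (Set.range fun j => e j t) = W t) ∧
      (∀ t (c : Fin r → L), ∑ j, c j • e j t = 0 → ∀ j, e j t ≠ 0 → c j = 0) := by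
  induction hk : ∑ t, Module.finrank L (W t) using Nat.strong_induction_on generalizing W with
  | _ k ih =>
  by_cases hne : ∃ t, W t ≠ ⊥
  · obtain ⟨e, W', he0, hef, hW', hs, hd⟩ := exists_split f W hW hne
    have hlt : ∑ t, Module.finrank L (W' t) < k := by
      rw [← hk]
      obtain ⟨t, ht⟩ := Function.ne_iff.1 he0
      refine Finset.sum_lt_sum (fun t _ => Submodule.finrank_mono (hs t).2.1)
        ⟨t, Finset.mem_univ _, Submodule.finrank_lt_finrank_of_lt ?_⟩
      refine lt_of_le_of_ne (hs t).2.1 fun h => ?_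
      have := hd t 1 (by rw [one_smul, h]; exact (hs t).1) ht
      exact one_ne_zero this
    obtain ⟨r, e', h1, h2, h3⟩ := ih _ hlt W' hW' rfl
    refine ⟨r + 1, Fin.cons e e', ?_, ?_, ?_⟩
    · intro j
      refine Fin.cases ?_ (fun j => ?_) j
      · simpa using hef
      · simpa using h1 j
    · intro t
      have hr : (Set.range fun j : Fin (r + 1) => (Fin.cons e e' : Fin (r + 1) → ∀ t, E t) j t) =
          insert (e t) (Set.range fun j => e' j t) := by
        ext y
        simp [Fin.exists_fin_succ, eq_comm]
      rw [hr, Submodule.span_insert, h2]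
      refine le_antisymm (sup_le ?_ (hs t).2.1) fun w hw => ?_
      · rw [Submodule.span_singleton_le_iff_mem]; exact (hs t).1
      · obtain ⟨c, hc⟩ := (hs t).2.2 w hw
        rw [← add_sub_cancel (c • e t) w]
        exact Submodule.add_mem_sup (Submodule.smul_mem _ _ (Submodule.mem_span_singleton_self _)) hc
    · intro t c hc
      rw [Fin.sum_univ_succ] at hc
      simp only [Fin.cons_zero, Fin.cons_succ] at hc
      have hmem : ∑ j : Fin r, c j.succ • e' j t ∈ W' t := by
        rw [← h2 t]
        exact Submodule.sum_mem _ fun j _ =>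
          Submodule.smul_mem _ _ (Submodule.subset_span ⟨j, rfl⟩)
      have hc0 : c 0 • e t ∈ W' t := by
        rw [eq_neg_of_add_eq_zero_left hc]; exact Submodule.neg_mem _ hmem
      have hz : c 0 • e t = 0 := by
        by_cases h : e t = 0
        · rw [h, smul_zero]
        · rw [hd t _ hc0 h, zero_smul]
      intro j
      refine Fin.cases ?_ (fun j => ?_) j
      · simpa using hd t _ hc0
      · rw [hz, zero_add] at hc
        simpa using h3 t _ hc j
  · push Not at hne
    exact ⟨0, fun j => j.elim0, fun j => j.elim0, fun t => by simp [hne t],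
      fun t c _ j => j.elim0⟩

end

/-- The matrix of a partial bijection given by labels. -/
def labelMatrix {α β ι : Type*} [DecidableEq ι] (R : Type*) [Zero R] [One R] (p : α → ι)
    (q : β → ι) : Matrix α β R :=
  Matrix.of fun a b => if p a = q b then 1 else 0

/-- Every chain of matrices over a field is equivalent to a chain of label matrices. -/
theorem exists_normal_form {L : Type u} [Field L] {m : ℕ} (n : Fin (m + 1) → ℕ)
    (N : ∀ i : Fin m, Matrix (Fin (n i.castSucc)) (Fin (n i.succ)) L) :
    ∃ (r : ℕ) (p : ∀ t, Fin (n t) → Fin r) (g : ∀ t, Matrix (Fin (n t)) (Fin (n t)) L),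
      (∀ t, Function.Injective (p t)) ∧ (∀ t, IsUnit (g t)) ∧
      ∀ i, g i.castSucc * N i = labelMatrix L (p i.castSucc) (p i.succ) * g i.succ := by
  classical
  obtain ⟨r, e, h1, h2, h3⟩ := exists_interval_basis
    (E := fun t => Fin (n t) → L) (fun i => (N i).vecMulLinear) (fun _ => ⊤) (by simp)
  have hli : ∀ t, LinearIndependent L fun j : {j // e j t ≠ 0} => e j t := by
    intro t
    rw [Fintype.linearIndependent_iff]
    intro c hc j
    have := h3 t (fun j => if h : e j t ≠ 0 then c ⟨j, h⟩ else 0) (by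
      rw [← Fintype.sum_subtype_add_sum_subtype (fun j => e j t ≠ 0),
        Finset.sum_congr rfl (g := fun j => c j • e j t) fun j _ => by rw [dif_pos j.2], hc,
        zero_add]
      exact Finset.sum_eq_zero fun j _ => by rw [dif_neg j.2, zero_smul]) j j.2
    simpa [j.2] using this
  have hsp : ∀ t, ⊤ ≤ Submodule.span L (Set.range fun j : {j // e j t ≠ 0} => e j t) := by
    intro t
    rw [← h2 t, Submodule.span_le]
    rintro _ ⟨j, rfl⟩
    by_cases h : e j t = 0
    · simp [h]
    · exact Submodule.subset_span ⟨⟨j, h⟩, rfl⟩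
  have hcard : ∀ t, Fintype.card (Fin (n t)) = Fintype.card {j // e j t ≠ 0} := fun t => by
    rw [← Module.finrank_eq_card_basis (Module.Basis.mk (hli t) (hsp t)),
      Module.finrank_fintype_fun_eq_card]
  let q : ∀ t, Fin (n t) ≃ {j // e j t ≠ 0} := fun t => Fintype.equivOfCardEq (hcard t)
  -- The label of a basis vector is the index of the summand it comes from. The basis vectors are
  -- the rows of `g t`, since the chain acts on row vectors.
  refine ⟨r, fun t a => (q t a).1, fun t => Matrix.of fun a => e (q t a) t,
    fun t => Subtype.val_injective.comp (q t).injective, fun t => ?_, fun i => ?_⟩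
  · rw [← Matrix.linearIndependent_rows_iff_isUnit]
    exact (hli t).comp _ (q t).injective
  · ext a b
    have hf := h1 (q i.castSucc a) i (q i.castSucc a).2
    have hl : (Matrix.of (fun a => e (q i.castSucc a) i.castSucc) * N i) a b =
        e (q i.castSucc a) i.succ b := by
      rw [← hf]; rfl
    refine hl.trans ?_
    rw [Matrix.mul_apply]
    simp only [labelMatrix, Matrix.of_apply, ite_mul, one_mul, zero_mul]
    by_cases h : e (q i.castSucc a) i.succ = 0
    · rw [h, Pi.zero_apply, Finset.sum_eq_zero]
      intro c _
      rw [if_neg]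
      intro hc
      exact (q i.succ c).2 (hc ▸ h)
    · obtain ⟨c, hc⟩ := (q i.succ).surjective ⟨_, h⟩
      rw [Finset.sum_eq_single c]
      · rw [if_pos (by rw [hc]), hc]
      · intro d _ hd
        rw [if_neg]
        intro hd'
        exact hd ((q i.succ).injective (by rw [hc]; exact Subtype.ext hd'.symm))
      · simp

end Chain

/-! ### The relations and their linearization at a label chain -/

namespace MatrixChain

open Chain

section

variable {m : ℕ} (n : Fin (m + 1) → ℕ)

/-- The index set of the entries of the square matrices. -/
abbrev SquareIndex : Type := Σ i : Fin (m + 1), Fin (n i) × Fin (n i)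

/-- The index set of the relations. -/
abbrev RelIndex : Type := Σ i : Fin m, Fin (n i.castSucc) × Fin (n i.succ)

variable {n} {A : Type*} [CommRing A]

/-- The square matrices with given entries. -/
def squares (y : SquareIndex n → A) (i : Fin (m + 1)) : Matrix (Fin (n i)) (Fin (n i)) A :=
  Matrix.of fun a b => y ⟨i, a, b⟩

/-- The rectangular matrices with given entries. -/
def rects (y : RelIndex n → A) (i : Fin m) :
    Matrix (Fin (n i.castSucc)) (Fin (n i.succ)) A :=
  Matrix.of fun a b => y ⟨i, a, b⟩

/-- The commutators `X_i N_i - N_i X_{i+1}`. -/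
def bracket (X : ∀ i : Fin (m + 1), Matrix (Fin (n i)) (Fin (n i)) A)
    (N : ∀ i : Fin m, Matrix (Fin (n i.castSucc)) (Fin (n i.succ)) A) (i : Fin m) :
    Matrix (Fin (n i.castSucc)) (Fin (n i.succ)) A :=
  X i.castSucc * N i - N i * X i.succ

theorem bracket_apply (X : ∀ i : Fin (m + 1), Matrix (Fin (n i)) (Fin (n i)) A)
    (N : ∀ i : Fin m, Matrix (Fin (n i.castSucc)) (Fin (n i.succ)) A) (i : Fin m) (a b) :
    bracket X N i a b = ∑ c, X i.castSucc a c * N i c b - ∑ c, N i a c * X i.succ c b := by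
  simp [bracket, Matrix.mul_apply]

/-- The relations are bilinear in `(X, N)`, so the directional derivative is the sum of the brackets
with one argument replaced by its tangent direction. -/
theorem sum_mul_aeval_pderiv_relation {K : Type*} [CommRing K] [Algebra K A] (x dx : Vars n → A)
    (s : RelIndex n) :
    ∑ v, dx v * MvPolynomial.aeval x (MvPolynomial.pderiv v (relation n K s)) =
      (bracket (squares (dx ∘ Sum.inl)) (rects (x ∘ Sum.inr)) s.1 +
        bracket (squares (x ∘ Sum.inl)) (rects (dx ∘ Sum.inr)) s.1) s.2.1 s.2.2 := by
  classical
  set d : MvPolynomial (Vars n) K → A := fun p =>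
    ∑ v, dx v * MvPolynomial.aeval x (MvPolynomial.pderiv v p) with hd
  have hX : ∀ w, d (MvPolynomial.X w) = dx w := fun w => by
    simp only [hd, MvPolynomial.pderiv_X]
    rw [Finset.sum_eq_single w]
    · simp
    · intro b _ hb; rw [Pi.single_eq_of_ne hb.symm]; simp
    · simp
  have hsub : ∀ p q, d (p - q) = d p - d q := fun p q => by
    simp only [hd, map_sub, mul_sub, Finset.sum_sub_distrib]
  have hsum : ∀ {k : ℕ} (p : Fin k → MvPolynomial (Vars n) K), d (∑ c, p c) = ∑ c, d (p c) :=
    fun p => by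
      simp only [hd, map_sum, Finset.mul_sum]
      exact Finset.sum_comm
  have hmul : ∀ p q, d (p * q) =
      d p * MvPolynomial.aeval x q + MvPolynomial.aeval x p * d q := fun p q => by
    simp only [hd, Derivation.leibniz, map_add, smul_eq_mul, map_mul, mul_add,
      Finset.sum_add_distrib, Finset.sum_mul, Finset.mul_sum]
    rw [add_comm]
    congr 1 <;> exact Finset.sum_congr rfl fun _ _ => by ring
  change d _ = _
  rw [Matrix.add_apply, bracket_apply, bracket_apply, relation, Matrix.sub_apply,
    Matrix.mul_apply, Matrix.mul_apply, hsub, hsum, hsum]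
  simp only [hmul, genX, genN, Matrix.of_apply, hX, MvPolynomial.aeval_X, Finset.sum_add_distrib,
    squares, rects, Function.comp]
  ring

theorem aeval_relation {K : Type*} [CommRing K] [Algebra K A] (x : Vars n → A) (s : RelIndex n) :
    MvPolynomial.aeval x (relation n K s) =
      bracket (squares (x ∘ Sum.inl)) (rects (x ∘ Sum.inr)) s.1 s.2.1 s.2.2 := by
  simp [relation, bracket_apply, Matrix.mul_apply, genX, genN, squares, rects]

end

section LabelChain

variable {m : ℕ} {n : Fin (m + 1) → ℕ} {r : ℕ} (p : ∀ t, Fin (n t) → Fin r)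

/-- The chain of label matrices. -/
def labelChain (A : Type*) [CommRing A] (i : Fin m) :
    Matrix (Fin (n i.castSucc)) (Fin (n i.succ)) A :=
  labelMatrix A (p i.castSucc) (p i.succ)

variable {A : Type*} [CommRing A]

/-- Tangent directions that hit given values of the linearized relations at a label chain. -/
def liftRect (r : RelIndex n → A) (i : Fin m) :
    Matrix (Fin (n i.castSucc)) (Fin (n i.succ)) A :=
  Matrix.of fun a b => if p i.castSucc a = p i.succ b then 0 else r ⟨i, a, b⟩

/-- The entries of the diagonal part of the tangent direction. -/
def liftDiag (r : RelIndex n → A) (t : Fin (m + 1)) (a : Fin (n t)) : A :=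
  -- A partial sum of values along one label. The inequality is strict so that passing from vertex
  -- `i` to `i + 1` adds exactly the terms at `i`; the sign makes the entry at `i` minus that at `i
  -- + 1` equal to the prescribed value.
  - ∑ s : RelIndex n, if s.1.castSucc < t ∧ p s.1.castSucc s.2.1 = p t a ∧
      p s.1.succ s.2.2 = p t a then r s else 0

/-- The linearized relations at a label chain, along the chosen tangent directions. -/
def testMap (Y : ∀ i : Fin (m + 1), Matrix (Fin (n i)) (Fin (n i)) A) :
    (RelIndex n → A) →ₗ[A] (RelIndex n → A) where
  toFun r s := (bracket (fun t => Matrix.diagonal (liftDiag p r t)) (labelChain p A) s.1 +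
    bracket Y (liftRect p r) s.1) s.2.1 s.2.2
  map_add' r r' := by
    have h1 : ∀ t, Matrix.diagonal (liftDiag p (r + r') t) =
        Matrix.diagonal (liftDiag p r t) + Matrix.diagonal (liftDiag p r' t) := fun t => by
      rw [Matrix.diagonal_add]
      congr 1
      funext a
      simp only [liftDiag, Pi.add_apply, ← neg_add, ← Finset.sum_add_distrib]
      congr 1
      exact Finset.sum_congr rfl fun s _ => by split_ifs <;> simp
    have h2 : ∀ i, liftRect p (r + r') i = liftRect p r i + liftRect p r' i := fun i => by
      ext a b
      simp only [liftRect, Matrix.of_apply, Matrix.add_apply, Pi.add_apply]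
      split_ifs <;> simp
    funext s
    simp only [bracket, h1, h2, Pi.add_apply, Matrix.add_apply,
      Matrix.sub_apply, Matrix.add_mul, Matrix.mul_add]
    ring
  map_smul' c r := by
    have h1 : ∀ t, liftDiag p (c • r) t = c • liftDiag p r t := fun t => by
      funext a
      simp only [liftDiag, Pi.smul_apply, smul_neg, Finset.smul_sum]
      congr 1
      exact Finset.sum_congr rfl fun s _ => by split_ifs <;> simp
    have h2 : ∀ i, liftRect p (c • r) i = c • liftRect p r i := fun i => by
      ext a b
      simp only [liftRect, Matrix.of_apply, Matrix.smul_apply, Pi.smul_apply]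
      split_ifs <;> simp
    funext s
    simp only [bracket, h1, h2, Matrix.diagonal_smul, Pi.smul_apply, Matrix.add_apply,
      Matrix.sub_apply, Matrix.smul_mul, Matrix.mul_smul, RingHom.id_apply, Matrix.smul_apply,
      smul_eq_mul]
    ring

theorem testMap_map {A' : Type*} [CommRing A'] (f : A →+* A')
    (Y : ∀ i : Fin (m + 1), Matrix (Fin (n i)) (Fin (n i)) A) (r : RelIndex n → A)
    (s : RelIndex n) :
    testMap p (fun i => (Y i).map f) (f ∘ r) s = f (testMap p Y r s) := by
  have h1 : ∀ t, Matrix.diagonal (liftDiag p (f ∘ r) t) =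
      (Matrix.diagonal (liftDiag p r t)).map f := fun t => by
    rw [Matrix.diagonal_map (map_zero f)]
    congr 1
    funext a
    simp only [liftDiag, Function.comp, map_neg, map_sum]
    congr 1
    exact Finset.sum_congr rfl fun s _ => by split_ifs <;> simp
  have h2 : ∀ i, liftRect p (f ∘ r) i = (liftRect p r i).map f := fun i => by
    ext a b
    simp only [liftRect, Matrix.of_apply, Matrix.map_apply, Function.comp]
    split_ifs <;> simp
  have h3 : ∀ i, labelChain p A' i = (labelChain p A i).map f := fun i => by
    ext a b
    simp only [labelChain, labelMatrix, Matrix.of_apply, Matrix.map_apply]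
    split_ifs <;> simp
  simp only [testMap, LinearMap.coe_mk, AddHom.coe_mk, bracket, h1, h2, h3, ← Matrix.map_mul,
    Matrix.add_apply, Matrix.sub_apply, Matrix.map_apply, map_add, map_sub]

theorem map_toMatrix_testMap {A' : Type*} [CommRing A'] (f : A →+* A')
    (Y : ∀ i : Fin (m + 1), Matrix (Fin (n i)) (Fin (n i)) A) :
    f.mapMatrix (LinearMap.toMatrix' (testMap p Y)) =
      LinearMap.toMatrix' (testMap p fun i => (Y i).map f) := by
  ext s s'
  rw [RingHom.mapMatrix_apply, Matrix.map_apply, LinearMap.toMatrix'_apply,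
    LinearMap.toMatrix'_apply, ← testMap_map]
  have hs : f ∘ Pi.single s' (1 : A) = Pi.single s' (1 : A') := by
    funext j
    by_cases h : j = s'
    · subst h; simp
    · simp [h]
  rw [hs]

/-- The diagonal matrices with one indeterminate for each label. -/
def labelDiag (x : Fin r → A) (t : Fin (m + 1)) : Matrix (Fin (n t)) (Fin (n t)) A :=
  Matrix.diagonal fun a => x (p t a)

theorem bracket_labelDiag (x : Fin r → A) (N : ∀ i : Fin m, Matrix (Fin (n i.castSucc)) (Fin (n i.succ)) A)
    (i : Fin m) (a b) :
    bracket (labelDiag p x) N i a b = (x (p _ a) - x (p _ b)) * N i a b := by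
  rw [bracket, Matrix.sub_apply, labelDiag, labelDiag, Matrix.diagonal_mul, Matrix.mul_diagonal]
  ring

theorem bracket_labelDiag_labelChain (x : Fin r → A) (i : Fin m) :
    bracket (labelDiag p x) (labelChain p A) i = 0 := by
  ext a b
  rw [bracket_labelDiag, labelChain, labelMatrix, Matrix.of_apply]
  split_ifs with h <;> simp [h]

variable (hp : ∀ t, Function.Injective (p t))
include hp

/-- The partial sums telescope, and injectivity of the labelings leaves a single term at position
`i`. -/
theorem liftDiag_sub (r : RelIndex n → A) (i : Fin m) (a b)
    (h : p i.castSucc a = p i.succ b) :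
    liftDiag p r i.castSucc a - liftDiag p r i.succ b = r ⟨i, a, b⟩ := by
  rw [liftDiag, liftDiag, neg_sub_neg, ← Finset.sum_sub_distrib, Finset.sum_eq_single ⟨i, a, b⟩]
  · simp [h]
  · rintro ⟨j, a', b'⟩ _ hne
    rw [← h]
    by_cases hj : j = i
    · subst hj
      have : ¬ (p j.castSucc a' = p j.castSucc a ∧ p j.succ b' = p j.castSucc a) := by
        rintro ⟨h1, h2⟩
        rw [h] at h2
        exact hne (by rw [hp _ h1, hp _ h2])
      rw [if_neg (fun h => this h.2), if_neg (fun h => this h.2), sub_zero]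
    · have : j.castSucc < i.succ ↔ j.castSucc < i.castSucc := by
        simp only [Fin.lt_def, Fin.val_succ, Fin.val_castSucc]
        have : (j : ℕ) ≠ i := fun h => hj (Fin.ext h)
        omega
      simp only [this, sub_self]
  · simp

/-- Entries with equal labels are reached by the diagonal direction, the others by the rectangular
one, scaled by a difference of label values. The map is thus diagonal, with nonzero determinant when
the values are distinct indeterminates. -/
theorem testMap_labelDiag (x : Fin r → A) (y : RelIndex n → A) (s : RelIndex n) :
    testMap p (labelDiag p x) y s =
      (if p s.1.castSucc s.2.1 = p s.1.succ s.2.2 then 1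
        else x (p s.1.castSucc s.2.1) - x (p s.1.succ s.2.2)) * y s := by
  obtain ⟨i, a, b⟩ := s
  change (bracket (fun t => Matrix.diagonal (liftDiag p y t)) (labelChain p A) i +
    bracket (labelDiag p x) (liftRect p y) i) a b = _
  rw [Matrix.add_apply, bracket_labelDiag, bracket, Matrix.sub_apply, Matrix.diagonal_mul,
    Matrix.mul_diagonal, labelChain, labelMatrix, liftRect, Matrix.of_apply, Matrix.of_apply]
  split_ifs with h
  · rw [mul_one, one_mul, liftDiag_sub p hp y i a b h]; simp
  · simp

end LabelChain

end MatrixChain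

/-! ### The commutant of a label chain and its generic point -/

theorem Matrix.exists_kernel_parametrization {K : Type*} [Field K] {α β : Type*} [Fintype α]
    [Fintype β] [DecidableEq α] [DecidableEq β] (Φ : Matrix β α K) :
    ∃ (e : ℕ) (B : Matrix α (Fin e) K) (C : Matrix (Fin e) α K) (Ψ : Matrix α β K),
      Φ * B = 0 ∧ C * B = 1 ∧ B * C + Ψ * Φ = 1 := by
  set f := Matrix.toLin' Φ with hf
  let b := Module.finBasis K (LinearMap.ker f)
  let B' : (Fin (Module.finrank K (LinearMap.ker f)) → K) →ₗ[K] (α → K) :=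
    (LinearMap.ker f).subtype ∘ₗ b.equivFun.symm.toLinearMap
  have hB'ker : LinearMap.ker B' = ⊥ := by
    rw [LinearMap.ker_eq_bot]
    exact Subtype.val_injective.comp b.equivFun.symm.injective
  obtain ⟨C', hC'⟩ := LinearMap.exists_leftInverse_of_injective B' hB'ker
  obtain ⟨s, hs⟩ := LinearMap.exists_rightInverse_of_surjective f.rangeRestrict
    f.range_rangeRestrict
  -- `Ψ'` recovers from `f v` the part of `v` complementary to the kernel. The resulting identity `B
  -- * C + Ψ * Φ = 1` survives any base change, so `B` parametrizes the kernel over every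
  -- `K`-algebra, not only over `K`.
  obtain ⟨Ψ', hΨ'⟩ := LinearMap.exists_extend ((LinearMap.id - B' ∘ₗ C') ∘ₗ s)
  have hfB : f ∘ₗ B' = 0 := by
    refine LinearMap.ext fun v => ?_
    exact (b.equivFun.symm v).2
  have hBC : ∀ v, f v = 0 → B' (C' v) = v := by
    intro v hv
    have hv' : B' (b.equivFun ⟨v, hv⟩) = v := by
      simp [B']
    rw [← hv', ← LinearMap.comp_apply C', hC', LinearMap.id_apply]
  have hsum : B' ∘ₗ C' + Ψ' ∘ₗ f = LinearMap.id := by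
    refine LinearMap.ext fun v => ?_
    have h1 : Ψ' (f v) = s (f.rangeRestrict v) - B' (C' (s (f.rangeRestrict v))) := by
      have := LinearMap.congr_fun hΨ' (f.rangeRestrict v)
      simpa using this
    have h2 : f (v - s (f.rangeRestrict v)) = 0 := by
      have := congrArg Subtype.val (LinearMap.congr_fun hs (f.rangeRestrict v))
      rw [map_sub, sub_eq_zero]
      exact this.symm
    have h3 := hBC _ h2
    rw [map_sub, map_sub] at h3
    change B' (C' v) + Ψ' (f v) = v
    rw [h1]
    linear_combination (exp := 1) h3
  refine ⟨_, LinearMap.toMatrix' B', LinearMap.toMatrix' C', LinearMap.toMatrix' Ψ', ?_, ?_, ?_⟩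
  · rw [← LinearMap.toMatrix'_toLin' Φ, ← LinearMap.toMatrix'_comp, ← hf, hfB, map_zero]
  · rw [← LinearMap.toMatrix'_comp, hC', LinearMap.toMatrix'_id]
  · rw [← LinearMap.toMatrix'_toLin' Φ, ← LinearMap.toMatrix'_comp, ← LinearMap.toMatrix'_comp,
      ← map_add, ← hf, hsum, LinearMap.toMatrix'_id]

namespace MatrixChain

open Chain

variable {m : ℕ} {n : Fin (m + 1) → ℕ}

/-- The list of entries of square matrices. -/
def squareEntries {A : Type*} (Y : ∀ i : Fin (m + 1), Matrix (Fin (n i)) (Fin (n i)) A)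
    (s : SquareIndex n) : A := Y s.1 s.2.1 s.2.2

@[simp] theorem squares_squareEntries {A : Type*} [CommRing A]
    (Y : ∀ i : Fin (m + 1), Matrix (Fin (n i)) (Fin (n i)) A) :
    squares (squareEntries Y) = Y := rfl

theorem bracket_conj {A : Type*} [CommRing A]
    {g k Y : ∀ i : Fin (m + 1), Matrix (Fin (n i)) (Fin (n i)) A}
    {M : ∀ i : Fin m, Matrix (Fin (n i.castSucc)) (Fin (n i.succ)) A} (hgk : ∀ i, g i * k i = 1)
    (i : Fin m) :
    bracket (fun i => k i * Y i * g i) (fun i => k i.castSucc * M i * g i.succ) i =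
      k i.castSucc * bracket Y M i * g i.succ := by
  simp only [bracket, Matrix.mul_sub, Matrix.sub_mul, Matrix.mul_assoc]
  congr 1
  · rw [← Matrix.mul_assoc (g i.castSucc), hgk, Matrix.one_mul]
  · rw [← Matrix.mul_assoc (g i.succ) (k i.succ), hgk, Matrix.one_mul]

section

variable {r : ℕ} (p : ∀ t, Fin (n t) → Fin r)

/-- The linear map sending square matrices to their commutators with a label chain. -/
def bracketMap (A : Type*) [CommRing A] : (SquareIndex n → A) →ₗ[A] (RelIndex n → A) where
  toFun y s := bracket (squares y) (labelChain p A) s.1 s.2.1 s.2.2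
  map_add' y y' := by
    funext s
    simp only [bracket_apply, squares, Matrix.of_apply, Pi.add_apply, add_mul, mul_add,
      Finset.sum_add_distrib]
    ring
  map_smul' c y := by
    funext s
    simp only [bracket_apply, squares, Matrix.of_apply, Pi.smul_apply, smul_eq_mul,
      RingHom.id_apply, mul_sub, Finset.mul_sum]
    congr 1 <;> exact Finset.sum_congr rfl fun _ _ => by ring

variable {A A' : Type*} [CommRing A] [CommRing A'] (f : A →+* A')

theorem bracketMap_eq_zero_iff (y : SquareIndex n → A) :
    bracketMap p A y = 0 ↔ ∀ i, bracket (squares y) (labelChain p A) i = 0 := by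
  refine ⟨fun h i => ?_, fun h => funext fun s => ?_⟩
  · ext a b; exact congrFun h ⟨i, a, b⟩
  · exact congrFun (congrFun (h s.1) s.2.1) s.2.2

theorem labelChain_map (i : Fin m) : (labelChain p A i).map f = labelChain p A' i := by
  ext a b
  simp only [labelChain, labelMatrix, Matrix.of_apply, Matrix.map_apply]
  split_ifs <;> simp

theorem squares_map (y : SquareIndex n → A) (i) : (squares y i).map f = squares (f ∘ y) i := rfl

theorem bracket_map (Y : ∀ i : Fin (m + 1), Matrix (Fin (n i)) (Fin (n i)) A)
    (M : ∀ i : Fin m, Matrix (Fin (n i.castSucc)) (Fin (n i.succ)) A) (i : Fin m) :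
    (bracket Y M i).map f = bracket (fun i => (Y i).map f) (fun i => (M i).map f) i := by
  simp only [bracket, Matrix.map_sub f (map_sub f), Matrix.map_mul]

theorem map_toMatrix_bracketMap :
    (LinearMap.toMatrix' (bracketMap p A)).map f = LinearMap.toMatrix' (bracketMap p A') := by
  ext s s'
  rw [Matrix.map_apply, LinearMap.toMatrix'_apply, LinearMap.toMatrix'_apply]
  have hs : f ∘ Pi.single s' (1 : A) = Pi.single s' (1 : A') := by
    funext j
    by_cases h : j = s'
    · subst h; simp
    · simp [h]
  have h := bracket_map f (squares (Pi.single s' (1 : A))) (labelChain p A) s.1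
  simp only [squares_map, labelChain_map, hs] at h
  exact congrFun (congrFun h s.2.1) s.2.2

/-- A parametrization over `K` of the commutant of a label chain. -/
theorem exists_commutant_parametrization (K : Type*) [Field K] :
    ∃ (e : ℕ) (B : Matrix (SquareIndex n) (Fin e) K) (C : Matrix (Fin e) (SquareIndex n) K),
      ∀ (A : Type u) [CommRing A] [Algebra K A],
        (∀ z, bracketMap p A ((B.map (algebraMap K A)).mulVec z) = 0) ∧
        (∀ z, (C.map (algebraMap K A)).mulVec ((B.map (algebraMap K A)).mulVec z) = z) ∧
        ∀ y, bracketMap p A y = 0 →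
          (B.map (algebraMap K A)).mulVec ((C.map (algebraMap K A)).mulVec y) = y := by
  obtain ⟨e, B, C, Ψ, h1, h2, h3⟩ :=
    Matrix.exists_kernel_parametrization (LinearMap.toMatrix' (bracketMap p K))
  refine ⟨e, B, C, fun A _ _ => ?_⟩
  have hφ : bracketMap p A =
      Matrix.toLin' ((LinearMap.toMatrix' (bracketMap p K)).map (algebraMap K A)) := by
    rw [map_toMatrix_bracketMap, Matrix.toLin'_toMatrix']
  have h1' := congrArg (fun M => M.map (algebraMap K A)) h1
  have h2' := congrArg (fun M => M.map (algebraMap K A)) h2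
  have h3' := congrArg (fun M => M.map (algebraMap K A)) h3
  simp only [Matrix.map_mul, Matrix.map_add _ (map_add (algebraMap K A)), Matrix.map_zero,
    Matrix.map_one, map_zero, map_one] at h1' h2' h3'
  refine ⟨fun z => ?_, fun z => ?_, fun y hy => ?_⟩
  · rw [hφ, Matrix.toLin'_apply, Matrix.mulVec_mulVec, h1', Matrix.zero_mulVec]
  · rw [Matrix.mulVec_mulVec, h2', Matrix.one_mulVec]
  · have := congrArg (fun M => M.mulVec y) h3'
    simp only [Matrix.add_mulVec, ← Matrix.mulVec_mulVec, Matrix.one_mulVec] at this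
    rw [hφ, Matrix.toLin'_apply] at hy
    rwa [hy, Matrix.mulVec_zero, add_zero] at this

/-- At a generic point of the commutant of a label chain, the linearized relations are
surjective. -/
theorem exists_tangent_of_algebraicIndependent (hp : ∀ t, Function.Injective (p t))
    {K L : Type u} [Field K] [Field L] [Algebra K L] {e : ℕ}
    {B : Matrix (SquareIndex n) (Fin e) K} {C : Matrix (Fin e) (SquareIndex n) K}
    (hBC : ∀ (A : Type u) [CommRing A] [Algebra K A] (y : SquareIndex n → A),
      bracketMap p A y = 0 →
        (B.map (algebraMap K A)).mulVec ((C.map (algebraMap K A)).mulVec y) = y)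
    {z : Fin e → L} (hz : AlgebraicIndependent K z)
    (R : ∀ i : Fin m, Matrix (Fin (n i.castSucc)) (Fin (n i.succ)) L) :
    ∃ (dY : ∀ i : Fin (m + 1), Matrix (Fin (n i)) (Fin (n i)) L)
      (dM : ∀ i : Fin m, Matrix (Fin (n i.castSucc)) (Fin (n i.succ)) L),
      ∀ i, bracket dY (labelChain p L) i +
        bracket (squares ((B.map (algebraMap K L)).mulVec z)) dM i = R i := by
  set Y : SquareIndex n → MvPolynomial (Fin e) K :=
    (B.map (algebraMap K _)).mulVec MvPolynomial.X with hY
  have hmap : ∀ {A : Type u} [CommRing A] [Algebra K A] (w : Fin e → A),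
      (MvPolynomial.aeval w : MvPolynomial (Fin e) K →ₐ[K] A).toRingHom.mapMatrix
        (LinearMap.toMatrix' (testMap p (squares Y))) =
      LinearMap.toMatrix' (testMap p (squares ((B.map (algebraMap K A)).mulVec w))) := by
    intro A _ _ w
    rw [map_toMatrix_testMap]
    have hw : (MvPolynomial.aeval w : MvPolynomial (Fin e) K →ₐ[K] A) ∘ Y =
        (B.map (algebraMap K A)).mulVec w := by
      funext s
      simp [hY, Matrix.mulVec, dotProduct]
    congr 2
    funext i
    rw [← hw]
    rfl
  -- The determinant is a polynomial in the coordinates of the commutant. The diagonal matrices with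
  -- one indeterminate per label lie in the commutant, and specializing there gives a product of
  -- nonzero factors.
  have hdet : (LinearMap.toMatrix' (testMap p (squares Y))).det ≠ 0 := by
    intro h0
    have hX : bracketMap p (MvPolynomial (Fin r) K)
        (squareEntries (labelDiag p MvPolynomial.X)) = 0 := by
      rw [bracketMap_eq_zero_iff]
      exact fun i => bracket_labelDiag_labelChain p _ i
    have h1 := congrArg Matrix.det (hmap (A := MvPolynomial (Fin r) K)
      ((C.map (algebraMap K _)).mulVec (squareEntries (labelDiag p MvPolynomial.X))))
    rw [← RingHom.map_det, h0, map_zero, hBC _ _ hX, squares_squareEntries] at h1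
    have h2 : LinearMap.toMatrix' (testMap p (labelDiag p
        (MvPolynomial.X : Fin r → MvPolynomial (Fin r) K))) =
        Matrix.diagonal fun s : RelIndex n => if p s.1.castSucc s.2.1 = p s.1.succ s.2.2 then 1
          else MvPolynomial.X (p s.1.castSucc s.2.1) - MvPolynomial.X (p s.1.succ s.2.2) := by
      ext1 s s'
      rw [LinearMap.toMatrix'_apply, testMap_labelDiag p hp]
      by_cases h : s = s'
      · subst h
        simp
      · rw [Matrix.diagonal_apply_ne _ h]
        simp [h]
    rw [h2, Matrix.det_diagonal] at h1
    refine Finset.prod_ne_zero_iff.2 (fun s _ => ?_) h1.symm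
    split_ifs with h
    · exact one_ne_zero
    · exact sub_ne_zero.2 fun h' => h (MvPolynomial.X_injective h')
  have hdet' : IsUnit (LinearMap.toMatrix'
      (testMap p (squares ((B.map (algebraMap K L)).mulVec z)))).det := by
    rw [← hmap z, ← RingHom.map_det]
    exact isUnit_iff_ne_zero.2 fun h => hdet (hz (h.trans (map_zero _).symm))
  set Q := LinearMap.toMatrix' (testMap p (squares ((B.map (algebraMap K L)).mulVec z))) with hQ
  set y : RelIndex n → L := Q⁻¹.mulVec fun s => R s.1 s.2.1 s.2.2 with hy
  have hQy : testMap p (squares ((B.map (algebraMap K L)).mulVec z)) y =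
      fun s => R s.1 s.2.1 s.2.2 := by
    rw [← LinearMap.toMatrix'_mulVec, ← hQ, hy, Matrix.mulVec_mulVec, Matrix.mul_nonsing_inv _ hdet',
      Matrix.one_mulVec]
  refine ⟨fun t => Matrix.diagonal (liftDiag p y t), liftRect p y, fun i => ?_⟩
  ext a b
  exact congrFun hQy ⟨i, a, b⟩

end

end MatrixChain

/-! ### Transcendence degree and tangent directions at a field-valued point -/

section

variable {K L : Type*} [Field K] [Field L] [Algebra K L] (M : IntermediateField K L)

theorem IntermediateField.matrix_mul_mem {α β γ : Type*} [Fintype β] {P : Matrix α β L}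
    {Q : Matrix β γ L} (hP : ∀ a b, P a b ∈ M) (hQ : ∀ a b, Q a b ∈ M) (a : α) (c : γ) :
    (P * Q) a c ∈ M := by
  rw [Matrix.mul_apply]
  exact sum_mem fun b _ => mul_mem (hP a b) (hQ b c)

theorem IntermediateField.matrix_mulVec_mem {α β : Type*} [Fintype β] (P : Matrix α β K)
    {z : β → L} (hz : ∀ b, z b ∈ M) (a : α) :
    (P.map (algebraMap K L)).mulVec z a ∈ M := by
  rw [Matrix.mulVec, dotProduct]
  exact sum_mem fun b _ => mul_mem (M.algebraMap_mem _) (hz b)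

theorem IntermediateField.matrix_inv_mem {α : Type*} [Fintype α] [DecidableEq α]
    {P Q : Matrix α α L} (hP : ∀ a b, P a b ∈ M) (hPQ : P * Q = 1) (a b : α) : Q a b ∈ M := by
  set G : Matrix α α M := Matrix.of fun a b => ⟨P a b, hP a b⟩ with hG
  have hGP : G.map (algebraMap M L) = P := rfl
  have hdet : IsUnit G.det := by
    rw [isUnit_iff_ne_zero]
    intro h0
    have h1 : P.det = 0 := by
      have := RingHom.map_det (algebraMap M L) G
      rw [h0, map_zero, RingHom.mapMatrix_apply, hGP] at this
      exact this.symm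
    have h2 := congrArg Matrix.det hPQ
    rw [Matrix.det_mul, h1, zero_mul, Matrix.det_one] at h2
    exact zero_ne_one h2
  have h3 : P * (G⁻¹).map (algebraMap M L) = 1 := by
    rw [← hGP, ← Matrix.map_mul, Matrix.mul_nonsing_inv _ hdet,
      Matrix.map_one _ (map_zero _) (map_one _)]
  have h4 : Q = (G⁻¹).map (algebraMap M L) := by
    rw [← Matrix.inv_eq_right_inv hPQ, Matrix.inv_eq_right_inv h3]
  rw [h4]
  exact (G⁻¹ a b).2

end

theorem trdeg_fractionRing_mvPolynomial (L : Type u) [Field L] (e : ℕ) :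
    Algebra.trdeg L (FractionRing (MvPolynomial (Fin e) L)) = e := by
  have : Algebra.IsAlgebraic (MvPolynomial (Fin e) L) (FractionRing (MvPolynomial (Fin e) L)) :=
    IsLocalization.isAlgebraic _ (nonZeroDivisors (MvPolynomial (Fin e) L))
  rw [← trdeg_add_eq L (MvPolynomial (Fin e) L),
    MvPolynomial.trdeg_of_isDomain, trdeg_eq_zero]
  simp

theorem isAlgebraic_of_adjoin_eq_top {F E : Type*} [Field F] [Field E] [Algebra F E] {s : Set E}
    (h : IntermediateField.adjoin F s = ⊤) : Algebra.IsAlgebraic (Algebra.adjoin F s) E := by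
  rw [← IntermediateField.isAlgebraic_adjoin_iff_top, h]
  exact ⟨fun y => isAlgebraic_algebraMap (⟨y, IntermediateField.mem_top⟩ :
    (⊤ : IntermediateField F E))⟩

namespace MatrixChain

open Chain

variable {m : ℕ} {n : Fin (m + 1) → ℕ}

theorem card_squareIndex : Fintype.card (SquareIndex n) = ∑ i, n i ^ 2 := by
  simp [sq]

/-- Square matrices and a chain of rectangular matrices commuting with them are conjugate, over
an extension with `e` more parameters, to a chain of label matrices and a point of its commutant,
in such a way that the conjugating matrices and the `e` coordinates of the point generate the
extension. -/
theorem exists_generating_conjugation {K L : Type u} [Field K] [Field L] [Algebra K L]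
    (x : Vars n → L) (hx : IntermediateField.adjoin K (Set.range x) = ⊤)
    (hrel : ∀ i, bracket (squares (x ∘ Sum.inl)) (rects (x ∘ Sum.inr)) i = 0) :
    ∃ (L' : Type u) (_ : Field L') (_ : Algebra K L') (_ : Algebra L L') (_ : IsScalarTower K L L')
      (r e : ℕ) (p : ∀ t, Fin (n t) → Fin r) (B : Matrix (SquareIndex n) (Fin e) K)
      (C : Matrix (Fin e) (SquareIndex n) K)
      (g k : ∀ t, Matrix (Fin (n t)) (Fin (n t)) L') (z : Fin e → L'),
      Algebra.trdeg L L' = e ∧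
      (∀ t, Function.Injective (p t)) ∧
      (∀ (A : Type u) [CommRing A] [Algebra K A] (y : SquareIndex n → A),
        bracketMap p A y = 0 →
          (B.map (algebraMap K A)).mulVec ((C.map (algebraMap K A)).mulVec y) = y) ∧
      (∀ t, g t * k t = 1) ∧
      (∀ t, (squares (x ∘ Sum.inl) t).map (algebraMap L L') =
        k t * squares ((B.map (algebraMap K L')).mulVec z) t * g t) ∧
      (∀ i, (rects (x ∘ Sum.inr) i).map (algebraMap L L') =
        k i.castSucc * labelChain p L' i * g i.succ) ∧
      IntermediateField.adjoin K (Set.range (Sum.elim (squareEntries g) z)) = ⊤ := by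
  obtain ⟨r, p, g, hp, hg, hgN⟩ := exists_normal_form n (rects (x ∘ Sum.inr))
  obtain ⟨e, B, C, hBC⟩ := exists_commutant_parametrization.{u} p K
  set X := squares (x ∘ Sum.inl) with hX
  set N := rects (x ∘ Sum.inr) with hN
  set k := fun t => (g t)⁻¹ with hk
  have hgk : ∀ t, g t * k t = 1 := fun t =>
    Matrix.mul_nonsing_inv _ ((Matrix.isUnit_iff_isUnit_det _).1 (hg t))
  have hkg : ∀ t, k t * g t = 1 := fun t =>
    Matrix.nonsing_inv_mul _ ((Matrix.isUnit_iff_isUnit_det _).1 (hg t))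
  have hNk : ∀ i, N i = k i.castSucc * labelChain p L i * g i.succ := fun i => by
    rw [Matrix.mul_assoc, labelChain, ← hgN, ← Matrix.mul_assoc, hkg, Matrix.one_mul]
  set Y := fun t => g t * X t * k t with hY
  have hXY : ∀ t, X t = k t * Y t * g t := fun t => by
    simp only [hY]
    rw [← Matrix.mul_assoc, ← Matrix.mul_assoc, hkg, Matrix.one_mul, Matrix.mul_assoc, hkg,
      Matrix.mul_one]
  have hY0 : ∀ i, bracket Y (labelChain p L) i = 0 := fun i => by
    have h1 := bracket_conj (Y := Y) (M := labelChain p L) hgk i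
    rw [← funext hXY, ← funext hNk, hrel i] at h1
    have h2 := congrArg (fun M => g i.castSucc * M * k i.succ) h1
    simp only [Matrix.mul_zero, Matrix.zero_mul] at h2
    rw [h2, ← Matrix.mul_assoc, ← Matrix.mul_assoc, hgk, Matrix.one_mul, Matrix.mul_assoc, hgk,
      Matrix.mul_one]
  -- The new parameters `s` are the coordinates of a generic element `h` of the commutant, which
  -- will be a generic element of the stabilizer of the label chain.
  let P := MvPolynomial (Fin e) L
  let L' := FractionRing P
  set s : Fin e → L' := fun j => algebraMap P L' (MvPolynomial.X j) with hs
  have hφ0 : ∀ i, (labelChain p L i).map (algebraMap L L') = labelChain p L' i :=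
    labelChain_map p _
  set h := squares ((B.map (algebraMap K L')).mulVec s) with hh
  have hhdet : ∀ t, IsUnit (h t).det := by
    intro t
    set hP := squares ((B.map (algebraMap K P)).mulVec MvPolynomial.X) with hhP
    have h1 : (hP t).map (algebraMap P L') = h t := by
      ext a b
      simp only [hP, hh, squares, Matrix.map_apply, Matrix.of_apply, Matrix.mulVec, dotProduct,
        map_sum, map_mul, hs, ← IsScalarTower.algebraMap_apply]
    -- The identity matrices lie in the commutant, so this determinant specializes to one.
    have h2 : (hP t).det ≠ 0 := by
      intro h0
      have hone : bracketMap p L (squareEntries (fun t => 1)) = 0 := by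
        rw [bracketMap_eq_zero_iff]
        intro i
        simp [bracket]
      set w := (C.map (algebraMap K L)).mulVec (squareEntries (fun t => 1)) with hw
      have h3 : (hP t).map (MvPolynomial.aeval w : P →ₐ[L] L) = 1 := by
        have h4 := (hBC L).2.2 _ hone
        have h5 : (MvPolynomial.aeval w : P →ₐ[L] L) ∘ ((B.map (algebraMap K P)).mulVec
            MvPolynomial.X) = squareEntries (fun t => 1) := by
          rw [← h4]
          funext q
          simp only [Function.comp, Matrix.mulVec, dotProduct, map_sum, map_mul, Matrix.map_apply,
            MvPolynomial.aeval_X]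
          refine Finset.sum_congr rfl fun j _ => ?_
          rw [IsScalarTower.algebraMap_apply K L P, AlgHom.commutes]
          rfl
        ext a b
        exact congrFun h5 ⟨t, a, b⟩
      have h6 := RingHom.map_det (MvPolynomial.aeval w : P →ₐ[L] L).toRingHom (hP t)
      rw [h0, map_zero] at h6
      have h7 : (MvPolynomial.aeval w : P →ₐ[L] L).toRingHom.mapMatrix (hP t) = 1 := h3
      rw [h7, Matrix.det_one] at h6
      exact zero_ne_one h6
    rw [← h1]
    have h8 := RingHom.map_det (algebraMap P L') (hP t)
    rw [RingHom.mapMatrix_apply] at h8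
    rw [← h8, isUnit_iff_ne_zero]
    exact fun h0 => h2 ((IsFractionRing.injective P L') (h0.trans (map_zero _).symm))
  have hh0 : ∀ i, bracket h (labelChain p L') i = 0 :=
    (bracketMap_eq_zero_iff p _).1 ((hBC L').1 s)
  have hcomm : ∀ i, h i.castSucc * labelChain p L' i = labelChain p L' i * h i.succ :=
    fun i => sub_eq_zero.1 (hh0 i)
  set l := fun t => (h t)⁻¹ with hl
  have hhl : ∀ t, h t * l t = 1 := fun t => Matrix.mul_nonsing_inv _ (hhdet t)
  have hlh : ∀ t, l t * h t = 1 := fun t => Matrix.nonsing_inv_mul _ (hhdet t)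
  set gL := fun t => (g t).map (algebraMap L L') with hgL
  set kL := fun t => (k t).map (algebraMap L L') with hkL
  set YL := fun t => (Y t).map (algebraMap L L') with hYL
  have hgkL : ∀ t, gL t * kL t = 1 := fun t => by
    simp only [hgL, hkL]
    rw [← Matrix.map_mul, hgk, Matrix.map_one _ (map_zero _) (map_one _)]
  have hkgL : ∀ t, kL t * gL t = 1 := fun t => by
    simp only [hgL, hkL]
    rw [← Matrix.map_mul, hkg, Matrix.map_one _ (map_zero _) (map_one _)]
  have hYL0 : ∀ i, bracket YL (labelChain p L') i = 0 := fun i => by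
    have := bracket_map (algebraMap L L') Y (labelChain p L) i
    rw [hY0 i, Matrix.map_zero _ (map_zero _)] at this
    simp only [hφ0] at this
    exact this.symm
  -- Changing `g` to `h g` and `Y` to `h Y h⁻¹` leaves both the label chain and the original tuple
  -- unchanged.
  set Y' := fun t => h t * YL t * l t with hY'
  have hY'0 : ∀ i, bracket Y' (labelChain p L') i = 0 := fun i => by
    have h1 := bracket_conj (Y := YL) (M := labelChain p L') hlh i
    rw [hYL0, Matrix.mul_zero, Matrix.zero_mul] at h1
    rw [← h1]
    congr 1
    funext j
    rw [hcomm, Matrix.mul_assoc, hhl, Matrix.mul_one]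
  set z := (C.map (algebraMap K L')).mulVec (squareEntries Y') with hz
  have hBz : squares ((B.map (algebraMap K L')).mulVec z) = Y' := by
    rw [hz, (hBC L').2.2 _ ((bracketMap_eq_zero_iff p (squareEntries Y')).2 hY'0), squares_squareEntries]
  have hgk' : ∀ t, (h t * gL t) * (kL t * l t) = 1 := fun t => by
    rw [Matrix.mul_assoc, ← Matrix.mul_assoc (gL t), hgkL, Matrix.one_mul, hhl]
  have hXL : ∀ t, (X t).map (algebraMap L L') = kL t * l t * Y' t * (h t * gL t) := fun t => by
    have h1 : (X t).map (algebraMap L L') = kL t * YL t * gL t := by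
      rw [hXY t, Matrix.map_mul, Matrix.map_mul]
    have h2 : l t * Y' t * h t = YL t := by
      simp only [hY']
      rw [← Matrix.mul_assoc, ← Matrix.mul_assoc, hlh, Matrix.one_mul, Matrix.mul_assoc, hlh,
        Matrix.mul_one]
    rw [h1, ← h2]
    simp only [Matrix.mul_assoc]
  have hNL : ∀ i, (N i).map (algebraMap L L') =
      kL i.castSucc * l i.castSucc * labelChain p L' i * (h i.succ * gL i.succ) := fun i => by
    have h1 : (N i).map (algebraMap L L') =
        kL i.castSucc * labelChain p L' i * gL i.succ := by
      rw [hNk i, Matrix.map_mul, Matrix.map_mul, hφ0]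
    have h2 : l i.castSucc * (labelChain p L' i * h i.succ) = labelChain p L' i := by
      rw [← hcomm, ← Matrix.mul_assoc, hlh, Matrix.one_mul]
    rw [h1]
    conv_lhs => rw [← h2]
    simp only [Matrix.mul_assoc]
  refine ⟨L', inferInstance, inferInstance, inferInstance, inferInstance, r, e, p, B, C,
    fun t => h t * gL t, fun t => kL t * l t, z, trdeg_fractionRing_mvPolynomial L e, hp,
    fun A _ _ => (hBC A).2.2, hgk', fun t => by rw [hBz]; exact hXL t, hNL, ?_⟩
  -- From `h g` and `z` one recovers the tuple, hence all of `L`, hence `g`. Then `h` is `(h g)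
  -- g⁻¹`, and `C` reads the parameters `s` off `h`.
  set M := IntermediateField.adjoin K
    (Set.range (Sum.elim (squareEntries fun t => h t * gL t) z)) with hM
  have hmem : ∀ w, Sum.elim (squareEntries fun t => h t * gL t) z w ∈ M := fun w =>
    IntermediateField.subset_adjoin _ _ ⟨w, rfl⟩
  have hgM : ∀ t a b, (h t * gL t) a b ∈ M := fun t a b => hmem (Sum.inl ⟨t, a, b⟩)
  have hkM : ∀ t a b, (kL t * l t) a b ∈ M := fun t =>
    M.matrix_inv_mem (hgM t) (hgk' t)
  have hYM : ∀ t a b, Y' t a b ∈ M := fun t a b => by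
    rw [← hBz]
    exact M.matrix_mulVec_mem B (fun j => hmem (Sum.inr j)) ⟨t, a, b⟩
  have h0M : ∀ i a b, labelChain p L' i a b ∈ M := fun i a b => by
    rw [labelChain, labelMatrix, Matrix.of_apply]
    split_ifs
    · exact one_mem M
    · exact zero_mem M
  have hxM : ∀ v, algebraMap L L' (x v) ∈ M := by
    rintro (⟨t, a, b⟩ | ⟨i, a, b⟩)
    · have := congrFun (congrFun (hXL t) a) b
      rw [show algebraMap L L' (x (Sum.inl ⟨t, a, b⟩)) = ((X t).map (algebraMap L L')) a b from rfl,
        this]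
      exact M.matrix_mul_mem (M.matrix_mul_mem (hkM t) (hYM t)) (hgM t) a b
    · have := congrFun (congrFun (hNL i) a) b
      rw [show algebraMap L L' (x (Sum.inr ⟨i, a, b⟩)) = ((N i).map (algebraMap L L')) a b from rfl,
        this]
      exact M.matrix_mul_mem (M.matrix_mul_mem (hkM _) (h0M i)) (hgM _) a b
  have hLM : ∀ y : L, algebraMap L L' y ∈ M := by
    have h1 : IntermediateField.adjoin K (Set.range x) ≤
        M.comap (IsScalarTower.toAlgHom K L L') := by
      rw [IntermediateField.adjoin_le_iff]
      rintro _ ⟨v, rfl⟩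
      exact hxM v
    intro y
    exact h1 (hx ▸ IntermediateField.mem_top : y ∈ IntermediateField.adjoin K (Set.range x))
  have hhM : ∀ t a b, h t a b ∈ M := fun t => by
    have h1 : h t = h t * gL t * kL t := by
      rw [Matrix.mul_assoc, hgkL, Matrix.mul_one]
    rw [h1]
    exact M.matrix_mul_mem (hgM t) fun a b => hLM _
  have hsM : ∀ j, s j ∈ M := fun j => by
    rw [← (hBC L').2.1 s]
    exact M.matrix_mulVec_mem C (fun q => hhM q.1 q.2.1 q.2.2) j
  have hPM : ∀ q : P, algebraMap P L' q ∈ M := by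
    intro q
    induction q using MvPolynomial.induction_on with
    | C a =>
      have := hLM a
      rwa [IsScalarTower.algebraMap_apply L P L'] at this
    | add q q' h1 h2 => rw [map_add]; exact add_mem h1 h2
    | mul_X q j h1 => rw [map_mul]; exact mul_mem h1 (hsM j)
  rw [eq_top_iff]
  rintro y -
  obtain ⟨a, b, -, rfl⟩ := IsFractionRing.div_surjective (A := P) y
  exact div_mem (hPM a) (hPM b)

/-- A field-valued point of the scheme of tuples generates an extension of transcendence degree at
most `∑ n_i ^ 2`. -/
theorem trdeg_le_and_linearIndependent {K L : Type u} [Field K] [Field L] [Algebra K L]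
    (x : Vars n → L) (hx : IntermediateField.adjoin K (Set.range x) = ⊤)
    (hrel : ∀ s, MvPolynomial.aeval x (relation n K s) = 0) :
    Algebra.trdeg K L ≤ (∑ i, n i ^ 2 : ℕ) ∧
      ((∑ i, n i ^ 2 : ℕ) ≤ Algebra.trdeg K L → ∀ U : RelIndex n → L,
        (∀ v, ∑ s, U s * MvPolynomial.aeval x (MvPolynomial.pderiv v (relation n K s)) = 0) →
          U = 0) := by
  have hrel' : ∀ i, bracket (squares (x ∘ Sum.inl)) (rects (x ∘ Sum.inr)) i = 0 := fun i => by
    ext a b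
    rw [← aeval_relation (K := K) x ⟨i, a, b⟩] 
    exact hrel _
  obtain ⟨L', _, _, _, _, r, e, p, B, C, g, k, z, htr, hp, hBC, hgk, hX, hN, hgen⟩ :=
    exists_generating_conjugation x hx hrel'
  have hkg : ∀ t, k t * g t = 1 := fun t => mul_eq_one_comm.1 (hgk t)
  have : Algebra.IsAlgebraic
      (Algebra.adjoin K (Set.range (Sum.elim (squareEntries g) z))) L' :=
    isAlgebraic_of_adjoin_eq_top hgen
  -- The `e` parameters of the stabilizer cancel the `e` coordinates `z` of the commutant, leaving
  -- the `∑ n_i ^ 2` entries of `g` as the bound.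
  have hadd : Algebra.trdeg K L + e = Algebra.trdeg K L' := by
    rw [← htr]
    exact trdeg_add_eq K L
  have hcard : Cardinal.mk (SquareIndex n ⊕ Fin e) = ((∑ i, n i ^ 2 : ℕ) : Cardinal) + e := by
    rw [Cardinal.mk_fintype, Fintype.card_sum, card_squareIndex, Fintype.card_fin, Nat.cast_add]
  refine ⟨?_, fun hle U hU => ?_⟩
  · have h1 := Algebra.IsAlgebraic.trdeg_le_cardinalMk K
      (Set.range (Sum.elim (squareEntries g) z))
    have h2 := Cardinal.mk_range_le_lift (f := Sum.elim (squareEntries g) z)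
    rw [hcard] at h2
    have h3 : Algebra.trdeg K L + e ≤ ((∑ i, n i ^ 2 : ℕ) : Cardinal) + e := by
      rw [hadd]
      have h4 := h1.trans (by simpa [-Nat.cast_sum] using h2)
      simpa [-Nat.cast_sum] using h4
    exact (Cardinal.add_le_add_iff_of_lt_aleph0 (Cardinal.natCast_lt_aleph0)).1 h3
  -- Equality leaves no room for an algebraic relation among the generators, so `z` is a generic
  -- point of the commutant.
  · have hind : AlgebraicIndependent K (Sum.elim (squareEntries g) z) := by
      refine (Algebra.IsAlgebraic.isTranscendenceBasis_of_lift_le_trdeg_of_finite K _ ?_).1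
      rw [hcard, ← hadd]
      simpa [-Nat.cast_sum] using hle
    have hz : AlgebraicIndependent K z := hind.comp Sum.inr Sum.inr_injective
    have hsurj : ∀ R : ∀ i : Fin m, Matrix (Fin (n i.castSucc)) (Fin (n i.succ)) L',
        ∃ dX dN, ∀ i, bracket dX (fun i => (rects (x ∘ Sum.inr) i).map (algebraMap L L')) i +
          bracket (fun t => (squares (x ∘ Sum.inl) t).map (algebraMap L L')) dN i = R i := by
      intro R
      obtain ⟨dY, dM, h⟩ := exists_tangent_of_algebraicIndependent p hp hBC hz
        (fun i => g i.castSucc * R i * k i.succ)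
      refine ⟨fun t => k t * dY t * g t, fun i => k i.castSucc * dM i * g i.succ, fun i => ?_⟩
      rw [funext hN, funext hX, bracket_conj hgk, bracket_conj hgk, ← Matrix.add_mul,
        ← Matrix.mul_add, h, ← Matrix.mul_assoc, ← Matrix.mul_assoc, hkg, Matrix.one_mul,
        Matrix.mul_assoc, hkg, Matrix.mul_one]
    -- A tangent direction over `L'` that moves only the relation `s₀` isolates the coefficient `U
    -- s₀`.
    funext s₀
    obtain ⟨dX, dN, h⟩ := hsurj fun i => Matrix.of fun a b =>
      if (⟨i, a, b⟩ : RelIndex n) = s₀ then 1 else 0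
    have h1 : ∀ s, ∑ v, (Sum.elim (squareEntries dX) (fun s => dN s.1 s.2.1 s.2.2)) v *
        algebraMap L L' (MvPolynomial.aeval x (MvPolynomial.pderiv v (relation n K s))) =
        if s = s₀ then 1 else 0 := by
      intro s
      simp only [← MvPolynomial.aeval_algebraMap_apply]
      rw [sum_mul_aeval_pderiv_relation]
      exact congrFun (congrFun (h s.1) s.2.1) s.2.2
    have h2 : algebraMap L L' (U s₀) = 0 := by
      calc algebraMap L L' (U s₀) = ∑ s, algebraMap L L' (U s) * (if s = s₀ then 1 else 0) := by
            simp
        _ = ∑ v, (Sum.elim (squareEntries dX) (fun s => dN s.1 s.2.1 s.2.2)) v *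
              algebraMap L L' (∑ s, U s *
                MvPolynomial.aeval x (MvPolynomial.pderiv v (relation n K s))) := by
            simp only [← h1, map_sum, map_mul, Finset.mul_sum]
            rw [Finset.sum_comm]
            exact Finset.sum_congr rfl fun v _ => Finset.sum_congr rfl fun s _ => by ring
        _ = 0 := by simp [hU]
    exact (map_eq_zero _).1 h2

end MatrixChain

/-! ### Dimension bounds and reducedness at minimal primes -/

theorem ringKrullDim_le_of_isIntegral (R S : Type*) [CommRing R] [CommRing S] [Algebra R S]
    [Algebra.IsIntegral R S] : ringKrullDim S ≤ ringKrullDim R :=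
  Order.krullDim_le_of_strictMono (PrimeSpectrum.comap (algebraMap R S)) fun P Q h =>
    have := P.2
    Ideal.IsIntegral.comap_lt_comap (R := R) (I := P.asIdeal) (J := Q.asIdeal) h

/-- By Noether normalization `T` is integral over a polynomial ring in `s` variables embedded in it.
Integrality bounds the dimension by `s`, and the embedding bounds `s` by the transcendence degree.
-/
theorem exists_ringKrullDim_le_and_le_trdeg (K T : Type u) [Field K] [CommRing T] [IsDomain T]
    [Algebra K T] [Algebra.FiniteType K T] :
    ∃ s : ℕ, ringKrullDim T ≤ s ∧ (s : Cardinal) ≤ Algebra.trdeg K T := by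
  obtain ⟨s, g, hg, hint⟩ := exists_integral_inj_algHom_of_fg K T
  refine ⟨s, ?_, ?_⟩
  · algebraize [g.toRingHom]
    have : Algebra.IsIntegral (MvPolynomial (Fin s) K) T := ⟨hint⟩
    refine (ringKrullDim_le_of_isIntegral (MvPolynomial (Fin s) K) T).trans ?_
    rw [MvPolynomial.ringKrullDim_of_isNoetherianRing]
    simp
  · have h := trdeg_le_of_injective g hg
    rw [MvPolynomial.trdeg_of_isDomain] at h
    simpa using h

theorem ringKrullDim_quotient_le_of_forall_minimalPrimes {S : Type*} [CommRing S] (J : Ideal S)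
    (d : WithBot ℕ∞) (h : ∀ P : Ideal S, P.IsPrime → J ≤ P → ringKrullDim (S ⧸ P) ≤ d) :
    ringKrullDim (S ⧸ J) ≤ d := by
  rw [ringKrullDim_quotient]
  refine iSup_le fun l => ?_
  let P := l.head.1
  have hJP : J ≤ P.asIdeal := l.head.2
  refine le_trans ?_ (h P.asIdeal P.2 hJP)
  rw [ringKrullDim_quotient]
  let l' : LTSeries (PrimeSpectrum.zeroLocus (P.asIdeal : Set S)) :=
    { length := l.length
      toFun := fun i => ⟨(l i).1, (l.head_le i : l.head ≤ l i)⟩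
      step := fun i => l.step i }
  exact le_iSup_of_le l' le_rfl

-- Localize at `P`. By `hind` the `g s` are independent in the cotangent space, whose dimension is
-- the height of `P` by regularity. Krull's height theorem bounds that height by the number of the
-- `g s`, so they form a basis and generate the maximal ideal by Nakayama.
open IsLocalRing in
theorem exists_mul_mem_span_of_mem_minimalPrimes {S ι : Type*} [CommRing S] [IsRegularRing S]
    [Fintype ι] (g : ι → S) {P : Ideal S} (hP : P ∈ (Ideal.span (Set.range g)).minimalPrimes)
    (hind : ∀ U : ι → S, ∑ s, U s * g s ∈ P ^ 2 → ∀ s, U s ∈ P) {f : S} (hf : f ∈ P) :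
    ∃ t ∉ P, t * f ∈ Ideal.span (Set.range g) := by
  have hPp : P.IsPrime := hP.1.1
  have hgP : ∀ s, g s ∈ P := fun s => hP.1.2 (Ideal.subset_span ⟨s, rfl⟩)
  let T := Localization.AtPrime P
  have hmax : P.map (algebraMap S T) = maximalIdeal T := Localization.AtPrime.map_eq_maximalIdeal
  have hgm : ∀ s, algebraMap S T (g s) ∈ maximalIdeal T := fun s => by
    rw [← hmax]
    exact Ideal.mem_map_of_mem _ (hgP s)
  let b : ι → CotangentSpace T := fun s => (maximalIdeal T).toCotangent ⟨_, hgm s⟩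
  have hb : LinearIndependent (ResidueField T) b := by
    rw [Fintype.linearIndependent_iff]
    intro a ha
    choose α hα using fun s => residue_surjective (a s)
    have h1 : ∑ s, α s * algebraMap S T (g s) ∈ maximalIdeal T ^ 2 := by
      have h2 : (maximalIdeal T).toCotangent (∑ s, α s • ⟨_, hgm s⟩) = 0 := by
        rw [map_sum, ← ha]
        refine Finset.sum_congr rfl fun s _ => ?_
        rw [map_smul, ← hα]
        rfl
      rw [Ideal.toCotangent_eq_zero] at h2
      simpa using h2
    obtain ⟨t, ht⟩ := IsLocalization.exist_integer_multiples_of_finite P.primeCompl α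
    choose U hU using ht
    have h3 : algebraMap S T (∑ s, U s * g s) ∈ (P ^ 2).map (algebraMap S T) := by
      rw [Ideal.map_pow, hmax, map_sum]
      have h4 := Ideal.mul_mem_left _ (algebraMap S T t) h1
      rw [Finset.mul_sum] at h4
      convert h4 using 1
      refine Finset.sum_congr rfl fun s _ => ?_
      rw [map_mul, hU, Algebra.smul_def, mul_assoc]
    rw [IsLocalization.algebraMap_mem_map_algebraMap_iff P.primeCompl] at h3
    obtain ⟨t', ht', h5⟩ := h3
    have h6 : ∀ s, t' * U s ∈ P := hind _ (by simpa [Finset.mul_sum, mul_assoc] using h5)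
    intro s
    have h7 : U s ∈ P := (hPp.mem_or_mem (h6 s)).resolve_left ht'
    have h8 : algebraMap S T t * α s ∈ maximalIdeal T := by
      rw [← hmax]
      have := Ideal.mem_map_of_mem (algebraMap S T) h7
      rwa [hU, Algebra.smul_def] at this
    have h9 : IsUnit (algebraMap S T t) := IsLocalization.map_units T t
    rw [← hα, residue_eq_zero_iff]
    exact (Ideal.unit_mul_mem_iff_mem _ h9).1 h8
  have hcard : Fintype.card ι = Module.finrank (ResidueField T) (CotangentSpace T) := by
    refine le_antisymm hb.fintype_card_le_finrank ?_
    have h1 := (IsRegularLocalRing.iff_finrank_cotangentSpace T).1 inferInstance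
    rw [IsLocalization.AtPrime.ringKrullDim_eq_height P T] at h1
    have h2 := Ideal.height_le_card_of_mem_minimalPrimes_span (Set.finite_range g) hP
    have h3 : (Set.range g).ncard ≤ Fintype.card ι := by
      rw [← Set.image_univ]
      refine (Set.ncard_image_le Set.finite_univ).trans ?_
      rw [Set.ncard_univ, Nat.card_eq_fintype_card]
    have h4 : ((Module.finrank (ResidueField T) (CotangentSpace T) : ℕ∞) : WithBot ℕ∞) ≤
        ((Fintype.card ι : ℕ∞) : WithBot ℕ∞) := by
      refine le_of_eq_of_le h1 (WithBot.coe_le_coe.2 (h2.trans ?_))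
      exact_mod_cast h3
    exact_mod_cast WithBot.coe_le_coe.1 h4
  have hspan := hb.span_eq_top_of_card_eq_finrank' hcard
  have h1 : Submodule.span T (Set.range fun s => (⟨_, hgm s⟩ : maximalIdeal T)) = ⊤ := by
    rw [← CotangentSpace.span_image_eq_top_iff, ← Set.range_comp]
    exact hspan
  have h2 : maximalIdeal T = (Ideal.span (Set.range g)).map (algebraMap S T) := by
    rw [Ideal.map_span, ← Set.range_comp]
    have := congrArg (Submodule.map (maximalIdeal T).subtype) h1
    rw [Submodule.map_span, ← Set.range_comp, Submodule.map_top, Submodule.range_subtype] at this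
    exact this.symm
  have h3 : algebraMap S T f ∈ (Ideal.span (Set.range g)).map (algebraMap S T) := by
    rw [← h2, ← hmax]
    exact Ideal.mem_map_of_mem _ hf
  rw [IsLocalization.algebraMap_mem_map_algebraMap_iff P.primeCompl] at h3
  exact h3

namespace MatrixChain

variable {m : ℕ} (n : Fin (m + 1) → ℕ) (K : Type u) [Field K]

/-- The coordinates of the generic point of a prime containing the relations. -/
theorem generic_point_of_prime {P : Ideal (MvPolynomial (Vars n) K)} [P.IsPrime]
    (hJP : Ideal.span (Set.range (relation n K)) ≤ P) :
    ringKrullDim (MvPolynomial (Vars n) K ⧸ P) ≤ (∑ i, n i ^ 2 : ℕ) ∧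
      (((∑ i, n i ^ 2 : ℕ) : WithBot ℕ∞) ≤ ringKrullDim (MvPolynomial (Vars n) K ⧸ P) →
        ∀ U : RelIndex n → MvPolynomial (Vars n) K,
          ∑ s, U s * relation n K s ∈ P ^ 2 → ∀ s, U s ∈ P) := by
  let T := MvPolynomial (Vars n) K ⧸ P
  let L := FractionRing T
  let x : Vars n → L := fun v => algebraMap T L (Ideal.Quotient.mk P (MvPolynomial.X v))
  have hx : ∀ f, MvPolynomial.aeval x f = algebraMap T L (Ideal.Quotient.mk P f) := by
    intro f
    have : MvPolynomial.aeval x = (IsScalarTower.toAlgHom K T L).comp (Ideal.Quotient.mkₐ K P) := by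
      ext v
      simp [x]
      rfl
    rw [this]
    rfl
  have hx0 : ∀ f, MvPolynomial.aeval x f = 0 ↔ f ∈ P := by
    intro f
    rw [hx, map_eq_zero_iff _ (IsFractionRing.injective T L), Ideal.Quotient.eq_zero_iff_mem]
  have htop : IntermediateField.adjoin K (Set.range x) = ⊤ := by
    have hT : ∀ y : T, algebraMap T L y ∈ IntermediateField.adjoin K (Set.range x) := by
      intro y
      obtain ⟨f, rfl⟩ := Ideal.Quotient.mk_surjective y
      rw [← hx]
      refine IntermediateField.algebra_adjoin_le_adjoin _ _ ?_
      rw [Algebra.adjoin_range_eq_range_aeval]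
      exact ⟨f, rfl⟩
    rw [eq_top_iff]
    rintro y -
    obtain ⟨a, b, -, rfl⟩ := IsFractionRing.div_surjective (A := T) y
    exact div_mem (hT a) (hT b)
  obtain ⟨h1, h2⟩ := trdeg_le_and_linearIndependent x htop
    fun s => (hx0 _).2 (hJP (Ideal.subset_span ⟨s, rfl⟩))
  obtain ⟨d, hd1, hd2⟩ := exists_ringKrullDim_le_and_le_trdeg K T
  have h3 : (d : Cardinal) ≤ Algebra.trdeg K L := hd2.trans
    (trdeg_le_of_injective (IsScalarTower.toAlgHom K T L) (IsFractionRing.injective T L))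
  refine ⟨hd1.trans ?_, fun hle U hU s => ?_⟩
  · have := h3.trans h1
    rw [Nat.cast_le] at this
    exact_mod_cast this
  · have hle' : ∑ i, n i ^ 2 ≤ d := by
      have := hle.trans hd1
      exact_mod_cast this
    have h4 := h2 (le_trans (by exact_mod_cast hle') h3) (fun s => MvPolynomial.aeval x (U s)) ?_
    · exact (hx0 _).1 (congrFun h4 s)
    intro v
    -- Derivatives of `P ^ 2` lie in `P`. At the generic point the terms where `U` is differentiated
    -- vanish, which leaves a linear relation between the gradients of the relations, in any
    -- characteristic.
    have h5 : MvPolynomial.pderiv v (∑ s, U s * relation n K s) ∈ P := by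
      have : ∀ f ∈ P ^ 2, MvPolynomial.pderiv v f ∈ P := by
        intro f hf
        rw [pow_two] at hf
        induction hf using Submodule.mul_induction_on' with
        | mem_mul_mem a ha b hb =>
          rw [Derivation.leibniz]
          exact P.add_mem (P.mul_mem_right _ ha) (P.mul_mem_right _ hb)
        | add a _ b _ ha hb =>
          rw [map_add]
          exact P.add_mem ha hb
      exact this _ hU
    rw [← hx0] at h5
    rw [map_sum, map_sum] at h5
    rw [← h5]
    refine Finset.sum_congr rfl fun s _ => ?_
    rw [Derivation.leibniz, map_add, smul_eq_mul, smul_eq_mul, map_mul, map_mul,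
      (hx0 (relation n K s)).2 (hJP (Ideal.subset_span ⟨s, rfl⟩)), zero_mul, add_zero]

theorem ringKrullDim_quotient_le {P : Ideal (MvPolynomial (Vars n) K)} [P.IsPrime]
    (hJP : Ideal.span (Set.range (relation n K)) ≤ P) :
    ringKrullDim (MvPolynomial (Vars n) K ⧸ P) ≤ (∑ i, n i ^ 2 : ℕ) :=
  (generic_point_of_prime n K hJP).1

theorem exists_mul_mem_span_relation {P : Ideal (MvPolynomial (Vars n) K)}
    (hP : P ∈ (Ideal.span (Set.range (relation n K))).minimalPrimes)
    (hdim : ((∑ i, n i ^ 2 : ℕ) : WithBot ℕ∞) ≤ ringKrullDim (MvPolynomial (Vars n) K ⧸ P))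
    {f : MvPolynomial (Vars n) K} (hf : f ∈ P) :
    ∃ t ∉ P, t * f ∈ Ideal.span (Set.range (relation n K)) :=
  have := hP.1.1
  exists_mul_mem_span_of_mem_minimalPrimes _ hP ((generic_point_of_prime n K hP.1.2).2 hdim) hf

end MatrixChain

/-! ### Homogeneous regular sequences -/

section

open RingTheory.Sequence

theorem isWeaklyRegular_iff_forall_getElem {S : Type*} [CommRing S] (gs : List S) :
    IsWeaklyRegular S gs ↔ ∀ (i : ℕ) (h : i < gs.length) (a : S),
      gs[i] * a ∈ Ideal.ofList (gs.take i) → a ∈ Ideal.ofList (gs.take i) := by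
  rw [isWeaklyRegular_iff]
  refine forall₂_congr fun i h => ?_
  rw [isSMulRegular_iff_right_eq_zero_of_smul]
  constructor
  · intro H a ha
    have h1 := H (Submodule.Quotient.mk a) (by
      rw [← Submodule.Quotient.mk_smul, Submodule.Quotient.mk_eq_zero]
      simpa using ha)
    rw [Submodule.Quotient.mk_eq_zero] at h1
    simpa using h1
  · intro H y hy
    obtain ⟨a, rfl⟩ := Submodule.Quotient.mk_surjective _ y
    rw [← Submodule.Quotient.mk_smul, Submodule.Quotient.mk_eq_zero] at hy
    rw [Submodule.Quotient.mk_eq_zero]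
    simpa using H a (by simpa using hy)

end

namespace MvPolynomial

open RingTheory.Sequence

attribute [local instance] MvPolynomial.gradedAlgebra

variable {σ : Type v} {R : Type u} [CommRing R]

theorem isHomogeneous_ofList {gs : List (MvPolynomial σ R)}
    (hgs : ∀ g ∈ gs, ∃ d ≠ 0, g.IsHomogeneous d) :
    (Ideal.ofList gs).IsHomogeneous (homogeneousSubmodule σ R) :=
  Ideal.homogeneous_span _ _ fun g hg =>
    let ⟨d, _, h⟩ := hgs g hg
    ⟨d, h⟩

/-- Up to a unit constant, `s` is `1 - w` with `w` in the ideal of the variables, so `a` is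
congruent to `w ^ N * a` modulo `J` for all `N`. For large `N` this has no component of a given
degree, and `J` contains the components of its elements. A homogeneous ideal can thus be tested near
the origin. -/
theorem mem_of_mul_mem_of_isUnit_constantCoeff {J : Ideal (MvPolynomial σ R)}
    (hJ : J.IsHomogeneous (homogeneousSubmodule σ R)) {s a : MvPolynomial σ R}
    (hs : IsUnit (constantCoeff s)) (ha : s * a ∈ J) : a ∈ J := by
  obtain ⟨c, hc⟩ := hs.exists_left_inv
  set w : MvPolynomial σ R := 1 - C c * s with hw
  have hw0 : w ∈ idealOfVars σ R ^ 1 := by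
    rw [mem_pow_idealOfVars_iff']
    intro x hx
    have hx0 : x = 0 := (Finsupp.degree_eq_zero_iff x).1 (Nat.lt_one_iff.1 hx)
    rw [hx0, ← constantCoeff_eq, hw, map_sub, map_mul, constantCoeff_C, hc, map_one, sub_self]
  have hpow : ∀ N, a - w ^ N * a ∈ J := by
    intro N
    have h1 : a - w ^ N * a = (∑ i ∈ Finset.range N, w ^ i) * (C c * (s * a)) := by
      have := geom_sum_mul_neg w N
      rw [show a - w ^ N * a = (1 - w ^ N) * a by ring, ← this, hw]
      ring
    rw [h1]
    exact J.mul_mem_left _ (J.mul_mem_left _ ha)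
  rw [← sum_homogeneousComponent a]
  refine J.sum_mem fun k _ => ?_
  have h1 := homogeneousComponent_mem_of_mem hJ (hpow (k + 1)) k
  have h2 : homogeneousComponent k (w ^ (k + 1) * a) = 0 := by
    ext x
    rw [coeff_homogeneousComponent, coeff_zero]
    split_ifs with hx
    · have h3 : w ^ (k + 1) * a ∈ idealOfVars σ R ^ (k + 1) := by
        refine Ideal.mul_mem_right _ _ (Ideal.pow_mem_pow ?_ _)
        rwa [pow_one] at hw0
      rw [mem_pow_idealOfVars_iff'] at h3
      exact h3 x (by omega)
    · rfl
  rwa [map_sub, h2, sub_zero] at h1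

theorem isWeaklyRegular_map_X {l : List σ} (hl : l.Nodup) :
    IsWeaklyRegular (MvPolynomial σ R) (l.map (X : σ → MvPolynomial σ R)) := by
  rw [isWeaklyRegular_iff_forall_getElem]
  intro i hi a ha
  rw [List.length_map] at hi
  have hspan : Ideal.ofList ((l.map (X : σ → MvPolynomial σ R)).take i) =
      Ideal.span (X '' {j | j ∈ l.take i}) := by
    rw [← List.map_take, Ideal.ofList]
    congr 1
    ext g
    exact List.mem_map
  rw [hspan, mem_ideal_span_X_image] at ha ⊢
  intro x hx
  rw [List.getElem_map] at ha
  obtain ⟨j, hj, hne⟩ := ha (x + Finsupp.single l[i] 1) (by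
    rw [mem_support_iff, add_comm, coeff_X_mul]
    exact mem_support_iff.1 hx)
  refine ⟨j, hj, ?_⟩
  have hji : j ≠ l[i] := by
    rintro rfl
    obtain ⟨k, hk, hki⟩ := List.getElem_of_mem hj
    rw [List.getElem_take, hl.getElem_inj_iff] at hki
    rw [List.length_take] at hk
    omega
  simpa [Finsupp.single_apply, hji.symm] using hne

end MvPolynomial

theorem ringKrullDim_quotient_map_le {S T : Type*} [CommRing S] [CommRing T] [Algebra S T]
    (M : Submonoid S) [IsLocalization M T] (I : Ideal S) :
    ringKrullDim (T ⧸ I.map (algebraMap S T)) ≤ ringKrullDim (S ⧸ I) := by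
  rw [ringKrullDim_quotient, ringKrullDim_quotient]
  refine Order.krullDim_le_of_strictMono
    (fun P => ⟨PrimeSpectrum.comap (algebraMap S T) P.1, Ideal.map_le_iff_le_comap.1 P.2⟩) ?_
  intro P Q hPQ
  have h1 : P.1.asIdeal < Q.1.asIdeal := hPQ
  refine lt_of_le_of_ne (show P.1.asIdeal.comap _ ≤ Q.1.asIdeal.comap _ from
    Ideal.comap_mono h1.le) fun h => h1.ne ?_
  have h2 : P.1.asIdeal.comap (algebraMap S T) = Q.1.asIdeal.comap (algebraMap S T) :=
    congrArg (fun x => x.1.asIdeal) h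
  exact (IsLocalization.map_under M T P.1.asIdeal).symm.trans
    ((congrArg (Ideal.map (algebraMap S T)) h2).trans (IsLocalization.map_under M T Q.1.asIdeal))

namespace MvPolynomial

open RingTheory.Sequence IsLocalRing

attribute [local instance] MvPolynomial.gradedAlgebra

variable {σ : Type v} [Fintype σ] {K : Type u} [Field K] {gs : List (MvPolynomial σ K)} {D : ℕ}

/-- Homogeneous polynomials over a field which cut out a closed subscheme of the expected
dimension form a regular sequence, and the quotient is equidimensional without embedded
components. -/
theorem isWeaklyRegular_and_associatedPrimes (hgs : ∀ g ∈ gs, ∃ d ≠ 0, g.IsHomogeneous d)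
    (hcard : D + gs.length = Fintype.card σ)
    (hdim : ringKrullDim (MvPolynomial σ K ⧸ Ideal.ofList gs) ≤ D) :
    IsWeaklyRegular (MvPolynomial σ K) gs ∧
      ∀ P ∈ associatedPrimes (MvPolynomial σ K) (MvPolynomial σ K ⧸ Ideal.ofList gs),
        P ∈ (Ideal.ofList gs).minimalPrimes ∧ ringKrullDim (MvPolynomial σ K ⧸ P) = D ∧
          P ≤ RingHom.ker (constantCoeff : MvPolynomial σ K →+* K) := by
  classical
  let S := MvPolynomial σ K
  let m : Ideal S := RingHom.ker (constantCoeff : MvPolynomial σ K →+* K)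
  have : m.IsPrime := RingHom.ker_isPrime _
  let T := Localization.AtPrime m
  set J : Ideal S := Ideal.ofList gs with hJ
  have hJh : J.IsHomogeneous (homogeneousSubmodule σ K) := isHomogeneous_ofList hgs
  have hm : ∀ s : S, s ∉ m → IsUnit (constantCoeff s) := fun s hs =>
    isUnit_iff_ne_zero.2 fun h => hs h
  have hgm : ∀ g ∈ gs, g ∈ m := by
    intro g hg
    obtain ⟨d, hd, h⟩ := hgs g hg
    change constantCoeff g = 0
    rw [constantCoeff_eq]
    exact h.coeff_eq_zero (by simpa using hd.symm)
  let ts := gs.map (algebraMap S T)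
  have hts : ∀ l : List S, Ideal.ofList (l.map (algebraMap S T)) =
      (Ideal.ofList l).map (algebraMap S T) := fun l => (Ideal.map_ofList _ _).symm
  -- Ideals generated by some of the `gs` are contracted from the localization at the origin, so
  -- regularity may be checked there.
  have hcontr : ∀ (l : List S), (∀ g ∈ l, g ∈ gs) → ∀ a, algebraMap S T a ∈
      Ideal.ofList (l.map (algebraMap S T)) → a ∈ Ideal.ofList l := by
    intro l hl a ha
    rw [hts, IsLocalization.algebraMap_mem_map_algebraMap_iff m.primeCompl] at ha
    obtain ⟨t, ht, hta⟩ := ha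
    exact mem_of_mul_mem_of_isUnit_constantCoeff
      (isHomogeneous_ofList fun g hg => hgs g (hl g hg)) (hm t ht) hta
  -- The variables form a regular sequence, and `hcard` says that their number is `D` plus the
  -- number of equations.
  have hdepth : HasDepth T T (D + gs.length) := by
    refine ⟨((Finset.univ : Finset σ).toList.map (X : σ → S)).map (algebraMap S T), ?_, ?_, ?_⟩
    · simp [hcard]
    · intro r hr
      simp only [List.mem_map] at hr
      obtain ⟨_, ⟨v, -, rfl⟩, rfl⟩ := hr
      rw [← Localization.AtPrime.map_eq_maximalIdeal]
      refine Ideal.mem_map_of_mem _ ?_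
      change constantCoeff (X v) = 0
      simp
    · refine (isWeaklyRegular_map_X (Finset.nodup_toList _)).isRegular_of_isLocalization_of_mem T m ?_
      intro r hr
      obtain ⟨v, -, rfl⟩ := List.mem_map.1 hr
      change constantCoeff (X v) = 0
      simp
  have htm : ∀ g ∈ ts, g ∈ maximalIdeal T := by
    intro g hg
    obtain ⟨g', hg', rfl⟩ := List.mem_map.1 hg
    rw [← Localization.AtPrime.map_eq_maximalIdeal]
    exact Ideal.mem_map_of_mem _ (hgm g' hg')
  obtain ⟨hreg, hdep⟩ := hdepth.isWeaklyRegular_and_hasDepth ts (by simp [ts]) htm (by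
    rw [smul_eq_mul, Ideal.mul_top, Module.supportDim_quotient_eq_ringKrullDim, hts]
    exact (ringKrullDim_quotient_map_le m.primeCompl J).trans hdim)
  have hP : ∀ P ∈ associatedPrimes S (S ⧸ J), ringKrullDim (S ⧸ P) = D ∧ P ≤ m := by
    intro P hP
    obtain ⟨hPp, y, hy⟩ := isAssociatedPrime_iff.1 hP
    obtain ⟨a, rfl⟩ := Ideal.Quotient.mk_surjective y
    have hPa : ∀ s, s ∈ P ↔ s * a ∈ J := fun s => by
      rw [hy, Submodule.mem_colon_singleton, Submodule.mem_bot, ← Ideal.Quotient.eq_zero_iff_mem, map_mul]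
      rfl
    have hPm : P ≤ m := by
      intro s hs
      by_contra hsm
      have h1 := mem_of_mul_mem_of_isUnit_constantCoeff hJh (hm s hsm) ((hPa s).1 hs)
      exact hPp.ne_top ((Ideal.eq_top_iff_one _).2 ((hPa 1).2 (by rwa [one_mul])))
    have hJP : J ≤ P := fun s hs => (hPa s).2 (J.mul_mem_right _ hs)
    have hdisj : Disjoint (m.primeCompl : Set S) (P : Set S) :=
      Set.disjoint_left.2 fun s hs hsP => hs (hPm hsP)
    let Q := P.map (algebraMap S T)
    have hQp : Q.IsPrime := IsLocalization.isPrime_of_isPrime_disjoint m.primeCompl T P hPp hdisj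
    -- Since `P` lies inside the ideal of the origin, it stays associated after localization, where
    -- depth bounds its dimension from below.
    have hQ : Q ∈ associatedPrimes T (T ⧸ (Ideal.ofList ts • ⊤ : Submodule T T)) := by
      refine isAssociatedPrime_iff.2 ⟨hQp, Submodule.Quotient.mk (algebraMap S T a), ?_⟩
      ext q
      rw [Submodule.mem_colon_singleton, Submodule.mem_bot, ← Submodule.Quotient.mk_smul,
        Submodule.Quotient.mk_eq_zero, smul_eq_mul, smul_eq_mul, Ideal.mul_top]
      obtain ⟨s, t, rfl⟩ := IsLocalization.exists_mk'_eq m.primeCompl q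
      have hu : ∀ (I : Ideal T) (b : T), IsLocalization.mk' T s t * b ∈ I ↔
          algebraMap S T s * b ∈ I := by
        intro I b
        rw [← IsLocalization.mk'_spec T s t, mul_comm _ (algebraMap S T t), mul_assoc]
        exact (Ideal.unit_mul_mem_iff_mem I (IsLocalization.map_units T t)).symm
      rw [hu, ← mul_one (IsLocalization.mk' T s t), hu, mul_one, ← map_mul]
      constructor
      · intro h
        have h1 : s ∈ P := by
          have := IsLocalization.under_map_of_isPrime_disjoint m.primeCompl T hPp hdisj
          rw [← this]
          exact h
        rw [hts]
        exact Ideal.mem_map_of_mem _ ((hPa s).1 h1)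
      · intro h
        exact Ideal.mem_map_of_mem _ ((hPa s).2 (hcontr gs (fun _ => id) _ h))
    refine ⟨le_antisymm ?_ ?_, hPm⟩
    · refine le_trans ?_ hdim
      exact ringKrullDim_le_of_surjective (Ideal.Quotient.factor hJP)
        (Ideal.Quotient.factor_surjective hJP)
    · exact (hdep.le_ringKrullDim_quotient hQ).trans
        (ringKrullDim_quotient_map_le m.primeCompl P)
  refine ⟨?_, fun P hPA => ⟨?_, hP P hPA⟩⟩
  · rw [isWeaklyRegular_iff_forall_getElem] at hreg ⊢
    intro i hi a ha
    refine hcontr (gs.take i) (fun g hg => List.mem_of_mem_take hg) a ?_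
    have h1 := hreg i (by simpa [ts] using hi) (algebraMap S T a)
    rw [← List.map_take] at h1
    refine h1 ?_
    rw [hts, List.getElem_map, ← map_mul]
    exact Ideal.mem_map_of_mem _ ha
  · have hPp := hPA.isPrime
    have hJP : J ≤ P := by
      have := hPA.annihilator_le
      rwa [Submodule.annihilator_top, Ideal.annihilator_quotient] at this
    obtain ⟨Q, hQ, hQP⟩ := Ideal.exists_minimalPrimes_le hJP
    have hQp := hQ.1.1
    have hQA : Q ∈ associatedPrimes S (S ⧸ J) := by
      refine Module.associatedPrimes.minimalPrimes_annihilator_subset_associatedPrimes S (S ⧸ J) ?_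
      rwa [Ideal.annihilator_quotient]
    -- The minimal prime `Q` is itself associated, so both quotients have dimension `D` and a strict
    -- inclusion is impossible.
    rcases hQP.eq_or_lt with h | h
    · rwa [← h]
    · have h1 := ringKrullDim_quotient_add_one_le_of_lt h
      rw [(hP Q hQA).1, (hP P hPA).1] at h1
      have h2 : D + 1 ≤ D := by exact_mod_cast h1
      omega

end MvPolynomial

namespace MvPolynomial

open RingTheory.Sequence

attribute [local instance] MvPolynomial.gradedAlgebra

/-- Homogeneous polynomials over a Noetherian local ring which form a regular sequence modulo a
non-zero-divisor of the base form a regular sequence, and that non-zero-divisor stays one on the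
quotient. -/
theorem isWeaklyRegular_of_map {σ : Type*} [Finite σ] {R k : Type*} [CommRing R] [CommRing k]
    [IsLocalRing R] [IsNoetherianRing R] (φ : R →+* k) (hφ : Function.Surjective φ) {ϖ : R}
    (hker : RingHom.ker φ = Ideal.span {ϖ}) (hϖ : ϖ ∈ nonZeroDivisors R)
    (hϖm : ϖ ∈ IsLocalRing.maximalIdeal R) {gs : List (MvPolynomial σ R)}
    (hgs : ∀ g ∈ gs, ∃ d ≠ 0, g.IsHomogeneous d)
    (hreg : IsWeaklyRegular (MvPolynomial σ k) (gs.map (map φ))) :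
    IsWeaklyRegular (MvPolynomial σ R) gs ∧
      ∀ a, C ϖ * a ∈ Ideal.ofList gs → a ∈ Ideal.ofList gs := by
  rw [isWeaklyRegular_iff_forall_getElem] at hreg
  have hsurj : Function.Surjective (map φ : MvPolynomial σ R →+* MvPolynomial σ k) :=
    map_surjective φ hφ
  have hkermap : ∀ a : MvPolynomial σ R, map φ a = 0 → ∃ b, a = C ϖ * b := by
    intro a ha
    have h1 : a ∈ (Ideal.span {ϖ}).map (C : R →+* MvPolynomial σ R) := by
      rw [mem_map_C_iff]
      intro d
      rw [← hker, RingHom.mem_ker, ← coeff_map, ha, coeff_zero]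
    rw [Ideal.map_span, Set.image_singleton, Ideal.mem_span_singleton] at h1
    exact h1
  have hstep : ∀ (i : ℕ) (h : i < gs.length) (a : MvPolynomial σ R),
      map φ (gs[i] * a) ∈ (Ideal.ofList (gs.take i)).map (map φ) →
        ∃ j ∈ Ideal.ofList (gs.take i), ∃ b, a = j + C ϖ * b := by
    intro i h a ha
    have h1 := hreg i (by simpa using h) (map φ a)
    rw [← List.map_take, ← Ideal.map_ofList, List.getElem_map, ← map_mul] at h1
    obtain ⟨j, hj, hja⟩ := (Ideal.mem_map_iff_of_surjective _ hsurj).1 (h1 ha)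
    obtain ⟨b, hb⟩ := hkermap (a - j) (by rw [map_sub, hja, sub_self])
    exact ⟨j, hj, b, by rw [← hb]; ring⟩
  -- If `ϖ a` equals `j + gs[i] * b`, regularity modulo `ϖ` gives `b = j' + ϖ b'`. Then `ϖ (a -
  -- gs[i] * b')` lies in the smaller ideal, and induction cancels `ϖ`.
  have key : ∀ i ≤ gs.length,
      (∀ a, C ϖ * a ∈ Ideal.ofList (gs.take i) → a ∈ Ideal.ofList (gs.take i)) := by
    intro i
    induction i with
    | zero =>
      intro _ a ha
      rw [List.take_zero, Ideal.ofList_nil, Ideal.mem_bot] at ha ⊢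
      ext d
      have := congrArg (coeff d) ha
      rw [coeff_C_mul, coeff_zero] at this
      exact (mul_left_mem_nonZeroDivisors_eq_zero_iff hϖ).1 this
    | succ i ih =>
      intro hi a ha
      have hi' : i < gs.length := hi
      rw [List.take_succ_eq_append_getElem hi', Ideal.ofList_append, Ideal.ofList_singleton] at ha ⊢
      obtain ⟨j, hj, y, hy, hjy⟩ := Submodule.mem_sup.1 ha
      obtain ⟨b, rfl⟩ := Ideal.mem_span_singleton.1 hy
      obtain ⟨j', hj', b', rfl⟩ := hstep i hi' b (by
        have h1 : gs[i] * b = C ϖ * a - j := by rw [← hjy]; ring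
        have h2 : map φ (C ϖ) = (0 : MvPolynomial σ k) := by
          have : φ ϖ = 0 := by
            rw [← RingHom.mem_ker, hker]
            exact Ideal.mem_span_singleton_self _
          rw [map_C, this, C_0]
        rw [h1, map_sub, map_mul, h2, zero_mul, zero_sub]
        exact neg_mem (Ideal.mem_map_of_mem _ hj))
      have h3 : a - gs[i] * b' ∈ Ideal.ofList (gs.take i) := by
        refine ih hi'.le _ ?_
        have : C ϖ * (a - gs[i] * b') = j + gs[i] * j' := by
          rw [mul_sub, ← hjy]; ring
        rw [this]
        exact add_mem hj (Ideal.mul_mem_left _ _ hj')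
      rw [← sub_add_cancel a (gs[i] * b')]
      exact Submodule.add_mem_sup h3 (Ideal.mem_span_singleton.2 (dvd_mul_right _ _))
  refine ⟨?_, by simpa using key gs.length le_rfl⟩
  rw [isWeaklyRegular_iff_forall_getElem]
  intro i hi a ha
  set J := Ideal.ofList (gs.take i) with hJ
  set N : Ideal (MvPolynomial σ R) := Submodule.comap (LinearMap.mulLeft (MvPolynomial σ R) gs[i]) J with hN
  have hmemN : ∀ b, b ∈ N ↔ gs[i] * b ∈ J := fun b => Iff.rfl
  -- Regularity modulo `ϖ` shows that the colon ideal `N` of `J` by `gs[i]` equals `J` up to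
  -- multiples of `ϖ`. Since `ϖ` is regular modulo `J`, the cofactors lie in `N` again.
  have hle : N ≤ J ⊔ (Ideal.span {C ϖ} : Ideal (MvPolynomial σ R)) • N := by
    intro b hb
    rw [hmemN] at hb
    obtain ⟨j, hj, b', rfl⟩ := hstep i hi b (Ideal.mem_map_of_mem _ hb)
    refine Submodule.add_mem_sup hj ?_
    refine Submodule.smul_mem_smul (Ideal.mem_span_singleton_self _) ?_
    rw [hmemN]
    refine key i hi.le _ ?_
    have : C ϖ * (gs[i] * b') = gs[i] * (j + C ϖ * b') - gs[i] * j := by ring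
    rw [this]
    exact sub_mem hb (Ideal.mul_mem_left _ _ hj)
  -- The element `ϖ` need not lie in the Jacobson radical of the polynomial ring, so Nakayama only
  -- provides `s` congruent to `1` modulo `ϖ` with `s N ≤ J`. Its constant term is a unit of the
  -- local ring, and homogeneity of `J` removes it.
  obtain ⟨s, hs, hsN⟩ := Submodule.exists_sub_one_mem_and_smul_le_of_fg_of_le_sup
    (IsNoetherian.noetherian N) le_rfl hle
  have hsu : IsUnit (constantCoeff s) := by
    obtain ⟨b, hb⟩ := Ideal.mem_span_singleton.1 hs
    have h1 : constantCoeff s = 1 + ϖ * constantCoeff b := by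
      rw [← constantCoeff_C σ ϖ, ← map_mul, ← hb, map_sub, map_one]; ring
    by_contra hu
    have h2 : constantCoeff s ∈ IsLocalRing.maximalIdeal R := hu
    have h3 : (1 : R) ∈ IsLocalRing.maximalIdeal R := by
      have := sub_mem h2 (Ideal.mul_mem_right (constantCoeff b) _ hϖm)
      rwa [h1, add_sub_cancel_right] at this
    exact (IsLocalRing.maximalIdeal.isMaximal R).ne_top ((Ideal.eq_top_iff_one _).2 h3)
  refine mem_of_mul_mem_of_isUnit_constantCoeff
    (isHomogeneous_ofList fun g hg => hgs g (List.mem_of_mem_take hg)) hsu ?_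
  exact hsN (Submodule.smul_mem_pointwise_smul a s N ((hmemN a).2 ha))

end MvPolynomial

/-! ### The scheme of tuples over a field -/

namespace MatrixChain

open MvPolynomial RingTheory.Sequence

variable {m : ℕ} (n : Fin (m + 1) → ℕ)

section

variable (R : Type u) [CommRing R]

/-- The relations, in some order. -/
def relations : List (MvPolynomial (Vars n) R) :=
  (Finset.univ : Finset (RelIndex n)).toList.map (relation n R)

theorem ofList_relations : Ideal.ofList (relations n R) = Ideal.span (Set.range (relation n R)) := by
  rw [Ideal.ofList]
  congr 1
  ext g
  simp [relations]

theorem length_relations : (relations n R).length = Fintype.card (RelIndex n) := by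
  simp [relations]

theorem relation_isHomogeneous (s : RelIndex n) : (relation n R s).IsHomogeneous 2 := by
  rw [relation, Matrix.sub_apply, Matrix.mul_apply, Matrix.mul_apply]
  refine IsHomogeneous.sub (IsHomogeneous.sum _ _ _ fun j _ => ?_)
    (IsHomogeneous.sum _ _ _ fun j _ => ?_)
  · exact (isHomogeneous_X R _).mul (isHomogeneous_X R _)
  · exact (isHomogeneous_X R _).mul (isHomogeneous_X R _)

theorem relations_isHomogeneous (g : MvPolynomial (Vars n) R) (hg : g ∈ relations n R) :
    ∃ d ≠ 0, g.IsHomogeneous d := by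
  obtain ⟨s, -, rfl⟩ := List.mem_map.1 hg
  exact ⟨2, two_ne_zero, relation_isHomogeneous n R s⟩

variable {R} in
theorem map_relation_map {R' : Type v} [CommRing R'] (φ : R →+* R') (s : RelIndex n) :
    MvPolynomial.map φ (relation n R s) = relation n R' s := by
  simp [relation, Matrix.mul_apply, genX, genN]

variable {R} in
theorem map_relations {R' : Type v} [CommRing R'] (φ : R →+* R') :
    (relations n R).map (MvPolynomial.map φ) = relations n R' := by
  simp [relations, Function.comp_def, map_relation_map]

end

section Field

variable (K : Type u) [Field K]

/-- There are as many relations as entries of the `N_i`, which leaves the entries of the `X_i` as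
expected dimension. -/
theorem card_vars : ∑ i, n i ^ 2 + (relations n K).length = Fintype.card (Vars n) := by
  rw [length_relations, ← card_squareIndex, Fintype.card_sum]

theorem ringKrullDim_quotient_ofList_le :
    ringKrullDim (MvPolynomial (Vars n) K ⧸ Ideal.ofList (relations n K)) ≤
      (∑ i, n i ^ 2 : ℕ) := by
  refine ringKrullDim_quotient_le_of_forall_minimalPrimes _ _ fun P hP hJP => ?_
  rw [ofList_relations] at hJP
  exact ringKrullDim_quotient_le n K hJP

theorem isWeaklyRegular_relations_of_field :
    IsWeaklyRegular (MvPolynomial (Vars n) K) (relations n K) :=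
  (isWeaklyRegular_and_associatedPrimes (relations_isHomogeneous n K) (card_vars n K)
    (ringKrullDim_quotient_ofList_le n K)).1

theorem mem_minimalPrimes_of_mem_associatedPrimes {P : Ideal (MvPolynomial (Vars n) K)}
    (hP : P ∈ associatedPrimes (MvPolynomial (Vars n) K) (CoordRing n K)) :
    P ∈ (Ideal.span (Set.range (relation n K))).minimalPrimes ∧
      ringKrullDim (MvPolynomial (Vars n) K ⧸ P) = (∑ i, n i ^ 2 : ℕ) := by
  have h := (isWeaklyRegular_and_associatedPrimes (relations_isHomogeneous n K) (card_vars n K)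
    (ringKrullDim_quotient_ofList_le n K)).2
  rw [ofList_relations] at h
  exact ⟨(h P hP).1, (h P hP).2.1⟩

theorem ringKrullDim_quotient_of_mem_minimalPrimes {P : Ideal (MvPolynomial (Vars n) K)}
    (hP : P ∈ (Ideal.span (Set.range (relation n K))).minimalPrimes) :
    ringKrullDim (MvPolynomial (Vars n) K ⧸ P) = (∑ i, n i ^ 2 : ℕ) := by
  refine (mem_minimalPrimes_of_mem_associatedPrimes n K ?_).2
  refine Module.associatedPrimes.minimalPrimes_annihilator_subset_associatedPrimes _ _ ?_
  rwa [Ideal.annihilator_quotient]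

theorem ringKrullDim_coordRing : ringKrullDim (CoordRing n K) = (∑ i, n i ^ 2 : ℕ) := by
  refine le_antisymm ?_ ?_
  · have := ringKrullDim_quotient_ofList_le n K
    rwa [ofList_relations] at this
  · have hne : Ideal.span (Set.range (relation n K)) ≠ ⊤ := by
      intro htop
      have h1 : Ideal.span (Set.range (relation n K)) ≤
          RingHom.ker (constantCoeff : MvPolynomial (Vars n) K →+* K) := by
        rw [Ideal.span_le]
        rintro _ ⟨s, rfl⟩
        change constantCoeff _ = 0
        rw [constantCoeff_eq]
        exact (relation_isHomogeneous n K s).coeff_eq_zero (by simp)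
      rw [htop, top_le_iff] at h1
      exact RingHom.ker_ne_top _ h1
    obtain ⟨P, hP⟩ := Ideal.nonempty_minimalPrimes hne
    rw [← ringKrullDim_quotient_of_mem_minimalPrimes n K hP]
    exact ringKrullDim_le_of_surjective (Ideal.Quotient.factor hP.1.2)
      (Ideal.Quotient.factor_surjective hP.1.2)

/-- The annihilator of a nonzero nilpotent lies in an associated prime, which is minimal of full
dimension. The ring is reduced there, so some element outside that prime kills the nilpotent, a
contradiction. -/
theorem isReduced_coordRing_of_field : IsReduced (CoordRing n K) := by
  refine ⟨fun y hy => ?_⟩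
  obtain ⟨f, rfl⟩ := Ideal.Quotient.mk_surjective y
  set J := Ideal.span (Set.range (relation n K)) with hJ
  by_contra h0
  obtain ⟨P, hP, hle⟩ := exists_le_isAssociatedPrime_of_isNoetherianRing
    (MvPolynomial (Vars n) K) (Ideal.Quotient.mk J f) h0
  obtain ⟨hPmin, hPdim⟩ := mem_minimalPrimes_of_mem_associatedPrimes n K hP
  have hfP : f ∈ P := by
    obtain ⟨k, hk⟩ := hy
    rw [← map_pow, Ideal.Quotient.eq_zero_iff_mem] at hk
    exact hPmin.1.1.mem_of_pow_mem k (hPmin.1.2 hk)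
  obtain ⟨t, htP, ht⟩ := exists_mul_mem_span_relation n K hPmin hPdim.ge hfP
  refine htP (hle ?_)
  rw [Submodule.mem_colon_singleton, Submodule.mem_bot]
  rw [← Ideal.Quotient.eq_zero_iff_mem, map_mul] at ht
  exact ht

end Field

end MatrixChain

/-! ### Fibres, base change and complete intersections -/

theorem exists_minimalPrime_topologicalKrullDim_eq {X A : Type*} [TopologicalSpace X] [CommRing A]
    (h : PrimeSpectrum A ≃ₜ X) {Z : Set X} (hZ : Z ∈ irreducibleComponents X) :
    ∃ P ∈ minimalPrimes A, topologicalKrullDim Z = ringKrullDim (A ⧸ P) := by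
  have h1 : h ⁻¹' Z ∈ irreducibleComponents (PrimeSpectrum A) := by
    refine preimage_mem_irreducibleComponents hZ h.isOpenEmbedding ?_
    rw [h.range_coe, Set.inter_univ]
    exact hZ.1.nonempty
  rw [← PrimeSpectrum.zeroLocus_minimalPrimes] at h1
  obtain ⟨P, hP, hPZ⟩ := h1
  refine ⟨P, hP, ?_⟩
  have hs : Function.Surjective (Ideal.Quotient.mk P) := Ideal.Quotient.mk_surjective
  have he : Topology.IsEmbedding (h ∘ PrimeSpectrum.comap (Ideal.Quotient.mk P)) :=
    h.isEmbedding.comp (PrimeSpectrum.isClosedEmbedding_comap_of_surjective _ _ hs).isEmbedding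
  have hr : Set.range (h ∘ PrimeSpectrum.comap (Ideal.Quotient.mk P)) = Z := by
    rw [Set.range_comp, range_comap_of_surjective _ _ hs, Ideal.mk_ker]
    rw [Function.comp_apply] at hPZ
    rw [hPZ, h.image_preimage]
  rw [← PrimeSpectrum.topologicalKrullDim_eq_ringKrullDim, ← hr]
  exact (IsHomeomorph.topologicalKrullDim_eq _ he.toHomeomorph.isHomeomorph).symm

theorem ringKrullDim_quotient_quotient {S : Type*} [CommRing S] {J : Ideal S} (P : Ideal (S ⧸ J)) :
    ringKrullDim ((S ⧸ J) ⧸ P) = ringKrullDim (S ⧸ P.comap (Ideal.Quotient.mk J)) := by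
  have hker : RingHom.ker ((Ideal.Quotient.mk P).comp (Ideal.Quotient.mk J)) =
      P.comap (Ideal.Quotient.mk J) := by
    rw [← RingHom.comap_ker, Ideal.mk_ker]
  have hs : Function.Surjective ((Ideal.Quotient.mk P).comp (Ideal.Quotient.mk J)) :=
    Ideal.Quotient.mk_surjective.comp Ideal.Quotient.mk_surjective
  rw [← hker]
  exact (ringKrullDim_eq_of_ringEquiv (RingHom.quotientKerEquivOfSurjective hs)).symm

open TensorProduct in
/-- Algebras over `R` and over `R'` with compatible generators are related by base change. -/
def tensorEquivOfGenerators {ι R R' B C : Type*} [CommRing R] [CommRing R'] [Algebra R R']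
    [CommRing B] [Algebra R B] [CommRing C] [Algebra R C] [Algebra R' C] [IsScalarTower R R' C]
    {x : ι → B} {y : ι → C} (hx : Algebra.adjoin R (Set.range x) = ⊤)
    (hy : Algebra.adjoin R' (Set.range y) = ⊤) (φ : B →ₐ[R] C) (hφ : ∀ v, φ (x v) = y v)
    (ψ : C →ₐ[R'] R' ⊗[R] B) (hψ : ∀ v, ψ (y v) = 1 ⊗ₜ x v) : R' ⊗[R] B ≃ₐ[R'] C :=
  AlgEquiv.ofAlgHom
    (Algebra.TensorProduct.lift (Algebra.ofId _ _) φ fun _ _ => Commute.all _ _) ψ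
    (AlgHom.ext_of_adjoin_eq_top hy <| by
      rintro _ ⟨v, rfl⟩
      simp [hφ, hψ])
    (Algebra.TensorProduct.ext (Subsingleton.elim _ _) <| AlgHom.ext_of_adjoin_eq_top hx <| by
      rintro _ ⟨v, rfl⟩
      simp [hφ, hψ])

namespace MatrixChain

open MvPolynomial RingTheory.Sequence TensorProduct

variable {m : ℕ} (n : Fin (m + 1) → ℕ)

section BaseChange

variable (R : Type u) [CommRing R]

/-- The coordinates as elements of the coordinate ring. -/
def coord (v : Vars n) : CoordRing n R := Ideal.Quotient.mk _ (X v)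

/-- The homomorphism of algebras out of the coordinate ring with given values on coordinates. -/
def coordLift {A : Type*} [CommRing A] [Algebra R A] (x : Vars n → A)
    (hx : ∀ s, aeval x (relation n R s) = 0) : CoordRing n R →ₐ[R] A :=
  Ideal.Quotient.liftₐ _ (aeval x) fun a ha => by
    have h1 : Ideal.span (Set.range (relation n R)) ≤ RingHom.ker (aeval x : _ →ₐ[R] A) := by
      rw [Ideal.span_le]
      rintro _ ⟨s, rfl⟩
      exact hx s
    exact h1 ha

theorem coordLift_coord {A : Type*} [CommRing A] [Algebra R A] (x : Vars n → A)
    (hx : ∀ s, aeval x (relation n R s) = 0) (v : Vars n) : coordLift n R x hx (coord n R v) = x v :=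
  aeval_X x v

theorem adjoin_range_coord : Algebra.adjoin R (Set.range (coord n R)) = ⊤ := by
  have h1 : (aeval (coord n R) : _ →ₐ[R] CoordRing n R) = Ideal.Quotient.mkₐ R _ :=
    MvPolynomial.algHom_ext fun v => aeval_X _ v
  rw [Algebra.adjoin_range_eq_range_aeval, h1]
  exact (AlgHom.range_eq_top _).2 (Ideal.Quotient.mkₐ_surjective R _)

theorem aeval_coord (s : RelIndex n) : aeval (coord n R) (relation n R s) = 0 := by
  have h1 : (aeval (coord n R) : _ →ₐ[R] CoordRing n R) = Ideal.Quotient.mkₐ R _ :=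
    MvPolynomial.algHom_ext fun v => aeval_X _ v
  rw [h1]
  exact Ideal.Quotient.eq_zero_iff_mem.2 (Ideal.subset_span ⟨s, rfl⟩)

variable (R' : Type v) [CommRing R'] [Algebra R R']

theorem aeval_relation_of_algebra {A : Type*} [CommRing A] [Algebra R A] [Algebra R' A]
    [IsScalarTower R R' A] (x : Vars n → A) (s : RelIndex n) :
    aeval x (relation n R' s) = aeval x (relation n R s) := by
  rw [← map_relation_map n (algebraMap R R'), aeval_map_algebraMap]

theorem aeval_one_tmul {B : Type*} [CommRing B] [Algebra R B] (x : Vars n → B)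
    (hx : ∀ s, aeval x (relation n R s) = 0) (s : RelIndex n) :
    aeval (fun v => (1 : R') ⊗ₜ[R] x v) (relation n R' s) = 0 := by
  rw [aeval_relation_of_algebra n R R']
  have : (aeval (fun v => (1 : R') ⊗ₜ[R] x v) : MvPolynomial (Vars n) R →ₐ[R] R' ⊗[R] B) =
      Algebra.TensorProduct.includeRight.comp (aeval x) :=
    MvPolynomial.algHom_ext fun v => by simp
  rw [this, AlgHom.comp_apply, hx, map_zero]

theorem aeval_coord_of_algebra (s : RelIndex n) : aeval (coord n R') (relation n R s) = 0 :=
  (aeval_relation_of_algebra n R R' _ s).symm.trans (aeval_coord n R' s)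

/-- The formation of the coordinate ring commutes with base change. -/
def coordRingBaseChange : R' ⊗[R] CoordRing n R ≃ₐ[R'] CoordRing n R' :=
  tensorEquivOfGenerators (adjoin_range_coord n R) (adjoin_range_coord n R')
    (coordLift n R (coord n R') (aeval_coord_of_algebra n R R')) (coordLift_coord n R _ _)
    (coordLift n R' _ (aeval_one_tmul n R R' (coord n R) (aeval_coord n R)))
    (coordLift_coord n R' _ _)

theorem flat_coordRing_of_flat [Module.Flat R (CoordRing n R)] :
    Module.Flat R' (CoordRing n R') :=
  Module.Flat.of_linearEquiv (coordRingBaseChange n R R').symm.toLinearEquiv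

attribute [local instance] MvPolynomial.algebraMvPolynomial

/-- The polynomial ring over `R'` is the base change of `R'` to the polynomial ring over `R`, hence
flat over it, and flat maps preserve weakly regular sequences. -/
theorem isWeaklyRegular_relations_of_flat [Module.Flat R R']
    (h : IsWeaklyRegular (MvPolynomial (Vars n) R) (relations n R)) :
    IsWeaklyRegular (MvPolynomial (Vars n) R') (relations n R') := by
  have : Module.Flat (MvPolynomial (Vars n) R) (MvPolynomial (Vars n) R') :=
    Module.Flat.isBaseChange R _ R' _
      (Algebra.IsPushout.out : IsBaseChange (MvPolynomial (Vars n) R)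
        (IsScalarTower.toAlgHom R R' (MvPolynomial (Vars n) R')).toLinearMap)
  have h1 := h.of_flat (S := MvPolynomial (Vars n) R')
  rwa [show ⇑(algebraMap (MvPolynomial (Vars n) R) (MvPolynomial (Vars n) R')) =
    MvPolynomial.map (algebraMap R R') from rfl, map_relations] at h1

end BaseChange

theorem ringKrullDim_coordRing_quotient (K : Type u) [Field K] {P : Ideal (CoordRing n K)}
    (hP : P ∈ minimalPrimes (CoordRing n K)) :
    ringKrullDim (CoordRing n K ⧸ P) = (∑ i, n i ^ 2 : ℕ) := by
  rw [ringKrullDim_quotient_quotient]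
  refine ringKrullDim_quotient_of_mem_minimalPrimes n K ?_
  rw [Ideal.minimalPrimes_eq_comap]
  exact ⟨P, hP, rfl⟩

/-- Each fibre is the same scheme over a residue field, so the field case applies and no hypothesis
on `R` is needed. -/
theorem hasRelativeDimension_toBase (R : Type u) [CommRing R] :
    HasRelativeDimension (toBase n R) (∑ i, n i ^ 2) := by
  refine ⟨?_, fun y Z hZ => ?_⟩
  · refine (HasRingHomProperty.Spec_iff (P := @LocallyOfFiniteType)
      (φ := CommRingCat.ofHom (algebraMap R (CoordRing n R)))).2 ?_
    exact (RingHom.finiteType_algebraMap (A := R) (B := CoordRing n R)).2 inferInstance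
  · let p : PrimeSpectrum R := y
    let κ := p.asIdeal.ResidueField
    let e := (Spec.fiberToSpecResidueFieldIso R (CoordRing n R) p)
    let e1 : (toBase n R).fiber y ≅ Spec (CommRingCat.of (κ ⊗[R] CoordRing n R)) :=
      Arrow.leftFunc.mapIso e
    let e2 : Spec (CommRingCat.of (CoordRing n κ)) ≅ Spec (CommRingCat.of (κ ⊗[R] CoordRing n R)) :=
      Scheme.Spec.mapIso (coordRingBaseChange n R κ).toRingEquiv.toCommRingCatIso.op
    let h : PrimeSpectrum (CoordRing n κ) ≃ₜ (toBase n R).fiber y :=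
      (e2.hom.homeomorph).trans e1.inv.homeomorph
    obtain ⟨P, hP, hZP⟩ := exists_minimalPrime_topologicalKrullDim_eq h hZ
    exact hZP.trans (ringKrullDim_coordRing_quotient n κ hP)

theorem isCompleteIntersection_toBase (R : Type u) [CommRing R] [Nontrivial R]
    (hreg : IsWeaklyRegular (MvPolynomial (Vars n) R) (relations n R)) :
    IsCompleteIntersection (toBase n R) := by
  let e := renameEquiv R (Fintype.equivFin (Vars n))
  let gs := (relations n R).map e
  have hspan : Ideal.span (Set.range gs.get) =
      (Ideal.span (Set.range (relation n R))).map (e : _ →+* _) := by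
    rw [Set.range_list_get, ← ofList_relations, Ideal.map_ofList]
    rfl
  -- The relations vanish at the origin, so they do not generate the unit ideal.
  have hregular : IsRegular (MvPolynomial (Vars n) R) (relations n R) := by
    refine ⟨hreg, fun htop => ?_⟩
    rw [smul_eq_mul, Ideal.mul_top, ofList_relations] at htop
    have h1 : Ideal.span (Set.range (relation n R)) ≤
        RingHom.ker (constantCoeff : MvPolynomial (Vars n) R →+* R) := by
      rw [Ideal.span_le]
      rintro _ ⟨s, rfl⟩
      change constantCoeff _ = 0
      rw [constantCoeff_eq]
      exact (relation_isHomogeneous n R s).coeff_eq_zero (by simp)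
    rw [← htop, top_le_iff] at h1
    exact RingHom.ker_ne_top _ h1
  refine ⟨Fintype.card (Vars n), gs.length, gs.get, ?_, ?_⟩
  · rw [List.ofFn_get]
    refine (AddEquiv.isRegular_congr (e := e.toAddEquiv) ?_).1 hregular
    rw [List.forall₂_map_right_iff, List.forall₂_same]
    intro g _ x
    exact map_mul e g x
  · let E := Ideal.quotientEquivAlg _ _ e hspan
    refine ⟨(Scheme.Spec.mapIso E.toRingEquiv.toCommRingCatIso.op).symm, ?_⟩
    refine (Iso.inv_comp_eq _).2 ?_
    change _ = Spec.map (CommRingCat.ofHom E.toRingEquiv.toRingHom) ≫ Spec.map _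
    rw [← Spec.map_comp, ← CommRingCat.ofHom_comp]
    congr 2
    exact (E.toAlgHom.comp_algebraMap).symm

theorem isReduced_scheme_of_field (K : Type u) [Field K] : AlgebraicGeometry.IsReduced (scheme n K) :=
  (affine_isReduced_iff _).2 (isReduced_coordRing_of_field n K)

theorem topologicalKrullDim_scheme (K : Type u) [Field K] :
    topologicalKrullDim (scheme n K) = (∑ i, n i ^ 2 : ℕ) :=
  (PrimeSpectrum.topologicalKrullDim_eq_ringKrullDim _).trans (ringKrullDim_coordRing n K)

/-- Flatness embeds the coordinate ring into that of the generic fibre, which is reduced by the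
field case. -/
theorem isReduced_coordRing_of_flat (R : Type u) [CommRing R] [IsDomain R]
    [Module.Flat R (CoordRing n R)] : _root_.IsReduced (CoordRing n R) := by
  let K := FractionRing R
  have := isReduced_coordRing_of_field n K
  have hinj : Function.Injective ((coordRingBaseChange n R K).toRingEquiv.toRingHom.comp
      (Algebra.TensorProduct.includeRight : CoordRing n R →ₐ[R] K ⊗[R] CoordRing n R).toRingHom) :=
    (coordRingBaseChange n R K).injective.comp
      (Algebra.TensorProduct.includeRight_injective (IsFractionRing.injective R K))
  exact isReduced_of_injective _ hinj

/-! ### The ring of `ℓ`-adic integers -/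

section PadicInt

variable (ℓ : ℕ) [Fact ℓ.Prime]

theorem padicInt_isWeaklyRegular_and :
    IsWeaklyRegular (MvPolynomial (Vars n) ℤ_[ℓ]) (relations n ℤ_[ℓ]) ∧
      ∀ a, C (ℓ : ℤ_[ℓ]) * a ∈ Ideal.ofList (relations n ℤ_[ℓ]) →
        a ∈ Ideal.ofList (relations n ℤ_[ℓ]) := by
  refine isWeaklyRegular_of_map (PadicInt.toZMod (p := ℓ)) (ϖ := (ℓ : ℤ_[ℓ]))
    (gs := relations n ℤ_[ℓ]) (ZMod.ringHom_surjective _)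
    (by rw [PadicInt.ker_toZMod, PadicInt.maximalIdeal_eq_span_p])
    (mem_nonZeroDivisors_of_ne_zero ?_)
    (by rw [PadicInt.maximalIdeal_eq_span_p]; exact Ideal.mem_span_singleton_self _)
    (relations_isHomogeneous n _) ?_
  · exact_mod_cast (Fact.out : ℓ.Prime).ne_zero
  · rw [map_relations]
    exact isWeaklyRegular_relations_of_field n _

/-- Over a Dedekind domain flat means torsion-free, and a nonzero `ℓ`-adic integer is a unit times a
power of `ℓ`, so it suffices that `ℓ` is a non-zero-divisor. -/
instance padicInt_flat_coordRing : Module.Flat ℤ_[ℓ] (CoordRing n ℤ_[ℓ]) := by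
  have h := (padicInt_isWeaklyRegular_and n ℓ).2
  rw [ofList_relations] at h
  have h1 : ∀ y : CoordRing n ℤ_[ℓ], (ℓ : ℤ_[ℓ]) • y = 0 → y = 0 := by
    intro y hy
    obtain ⟨f, rfl⟩ := Ideal.Quotient.mk_surjective y
    rw [Ideal.Quotient.eq_zero_iff_mem]
    refine h f ?_
    rw [← Ideal.Quotient.eq_zero_iff_mem, map_mul, ← hy]
    exact (Algebra.smul_def (ℓ : ℤ_[ℓ]) (Ideal.Quotient.mk _ f : CoordRing n ℤ_[ℓ])).symm
  have h2 : ∀ (k : ℕ) (y : CoordRing n ℤ_[ℓ]), (ℓ : ℤ_[ℓ]) ^ k • y = 0 → y = 0 := by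
    intro k
    induction k with
    | zero => intro y hy; simpa using hy
    | succ k ih => intro y hy; exact h1 y (ih _ (by rwa [smul_smul, ← pow_succ]))
  rw [IsDedekindDomain.flat_iff_torsion_eq_bot, eq_bot_iff]
  rintro y ⟨⟨a, ha⟩, hay⟩
  have ha0 : a ≠ 0 := nonZeroDivisors.ne_zero ha
  have hay' : a • y = 0 := hay
  rw [PadicInt.unitCoeff_spec ha0, mul_smul] at hay'
  exact h2 _ y (((PadicInt.unitCoeff ha0).isUnit.smul_eq_zero).1 hay')

end PadicInt

end MatrixChain

end

theorem mainTheorem10 (ℓ : ℕ) [Fact ℓ.Prime]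
    -- `E` is a finite extension of the `ℓ`-adic numbers, and its ring of integers is the
    -- integral closure of the `ℓ`-adic integers in `E`
    (E : Type u) [Field E] [Algebra ℚ_[ℓ] E] [FiniteDimensional ℚ_[ℓ] E]
    [Algebra ℤ_[ℓ] E] [IsScalarTower ℤ_[ℓ] ℚ_[ℓ] E]
    -- `F` is the residue field of the ring of integers
    (F : Type v) [Field F] [Algebra (integralClosure ℤ_[ℓ] E) F]
    (hF : Function.Surjective (algebraMap (integralClosure ℤ_[ℓ] E) F))
    -- an ordered partition with `m + 1` parts
    (m : ℕ) (n : Fin (m + 1) → ℕ) (hn : ∀ i, 0 < n i) :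
    (AlgebraicGeometry.IsReduced (MatrixChain.scheme n (integralClosure ℤ_[ℓ] E)) ∧
      AlgebraicGeometry.Flat (MatrixChain.toBase n (integralClosure ℤ_[ℓ] E)) ∧
      MatrixChain.HasRelativeDimension (MatrixChain.toBase n (integralClosure ℤ_[ℓ] E))
        (∑ i, n i ^ 2) ∧
      MatrixChain.IsCompleteIntersection (MatrixChain.toBase n (integralClosure ℤ_[ℓ] E))) ∧
    (AlgebraicGeometry.IsReduced (MatrixChain.scheme n F) ∧
      MatrixChain.IsCompleteIntersection (MatrixChain.toBase n F) ∧
      topologicalKrullDim (MatrixChain.scheme n F) = (∑ i, n i ^ 2 : ℕ)) := by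
  have hZE : Function.Injective (algebraMap ℤ_[ℓ] E) := by
    rw [IsScalarTower.algebraMap_eq ℤ_[ℓ] ℚ_[ℓ] E]
    exact (algebraMap ℚ_[ℓ] E).injective.comp (IsFractionRing.injective ℤ_[ℓ] ℚ_[ℓ])
  have : FaithfulSMul ℤ_[ℓ] E := (faithfulSMul_iff_algebraMap_injective _ _).2 hZE
  -- Everything over the ring of integers is obtained from `ℤ_[ℓ]` by flat base change, so no
  -- uniformizer of `E` is needed.
  have : Module.Flat ℤ_[ℓ] (integralClosure ℤ_[ℓ] E) := inferInstance
  have : Module.Flat (integralClosure ℤ_[ℓ] E)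
      (MatrixChain.CoordRing n (integralClosure ℤ_[ℓ] E)) :=
    MatrixChain.flat_coordRing_of_flat n ℤ_[ℓ] _
  refine ⟨⟨?_, ?_, MatrixChain.hasRelativeDimension_toBase n _, ?_⟩,
    MatrixChain.isReduced_scheme_of_field n F, ?_, MatrixChain.topologicalKrullDim_scheme n F⟩
  · exact (affine_isReduced_iff _).2 (MatrixChain.isReduced_coordRing_of_flat n _)
  · exact Flat.SpecMap_iff.2 (RingHom.flat_algebraMap_iff.2 inferInstance)
  · exact MatrixChain.isCompleteIntersection_toBase n _
      (MatrixChain.isWeaklyRegular_relations_of_flat n ℤ_[ℓ] _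
        (MatrixChain.padicInt_isWeaklyRegular_and n ℓ).1)
  · exact MatrixChain.isCompleteIntersection_toBase n F
      (MatrixChain.isWeaklyRegular_relations_of_field n F)
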